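/- Let $\mathbb{R}[[x,y]]$ be the ring of formal power series in two variables over $\mathbb{R}$ and $\mathbb{R}((x,y))$ its field of fractions. An ordering of a field is a total order compatible with addition and multiplication, i.e. one that makes it an ordered field. A preordering of a commutative ring $A$ is a subset of $A$ that contains all squares and is closed under addition and multiplication; the preordering generated by a subset of $A$ is the smallest preordering containing it. Suppose $f\in\mathbb{R}[[x,y]]$ and $n$ is a positive integer. (1) If $f\ge 0$ at each ordering of $\mathbb{R}((x,y))$ satisfying $y>0$ and $x^{2n}-y>0$, then $f$ lies in the preordering of $\mathbb{R}[[x,y]]$ generated by $y$ and $x^{2n}-y$. (2) If $f\ge 0$ at each ordering of $\mathbb{R}((x,y))$ satisfying $x>0$, $y>0$ and $x^n-y>0$, then $f$ lies in the preordering of $\mathbb{R}[[x,y]]$ generated by $x$, $y$ and $x^n-y$. -/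

import Mathlib

/-- The ring `ℝ⟦x, y⟧` of formal power series in two variables. -/
abbrev PowerSeriesXY : Type := MvPowerSeries (Fin 2) ℝ

/-- The field `ℝ((x, y))`, the field of fractions of `ℝ⟦x, y⟧`. -/
abbrev FracXY : Type := FractionRing PowerSeriesXY

namespace PowerSeriesXY

/-- The variable `x`. -/
noncomputable abbrev x : PowerSeriesXY := MvPowerSeries.X 0

/-- The variable `y`. -/
noncomputable abbrev y : PowerSeriesXY := MvPowerSeries.X 1

end PowerSeriesXY

/-- The preordering of a commutative ring `A` generated by `S`: the smallest subsemiring of `A`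
containing all squares and `S`. (As usual in real algebra, `-1` is not required to lie outside.) -/
def generatedPreordering {A : Type*} [CommRing A] (S : Set A) : Subsemiring A :=
  Subsemiring.closure ({a : A | IsSquare a} ∪ S)

/-! Work in ℝ⟦x⟧⟦y⟧. For (1), powers of `C X` and Weierstrass preparation reduce a nonzero f to a
unit times irreducible distinguished polynomials P in y. For each P, let θ be the class of y in L =
ℝ((x))[y]/(P), and put w = x^(2n) - θ. If -1, -θ or -w is a square in L, a norm computation writes
P, up to sign, as a² + b², a² + y b² or a² + (x^(2n) - y) b², so P or -P lies in the preordering.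

Otherwise L is discretely valued with residue field ℝ, and its Henselian property makes signs depend
on leading coefficients. An ordering of L makes θ and w positive unless both have odd value. In that
exceptional case θ dominates x^(2n), and the Newton polygon shows that P behaves on the strip like a
power of x times a unit. This is `strip_trichotomy_of_irreducible`.

If θ and w are positive in some ordering of L, that ordering lifts to two orderings of ℝ⟦x⟧⟦y⟧ in
which P has opposite signs and the cofactor the same sign (`not_forall_pos_of_hasInteriorZero`).
Hence nonnegativity of f forces such P to occur with even multiplicity. What remains is an element
of the preordering times a monomial-like g. Orderings with y infinitesimal and x of either sign show
that g is a positive unit times an even power x^(2k) up to smaller terms. Then g - δ x^(2k) lies in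
the preordering for some δ > 0 (`IsMonomialOnStrip.exists_sub_mem`), and so does g.

For (2), apply (1) to f(x², y) and take the part even in x of the resulting certificate: the even
part of (b(x²) + x c(x²))² is b² + x c² evaluated at x². -/

section

/-! ### The `x`-adic norm on finite extensions of ℝ((x)). -/

open LaurentSeries PowerSeries

/-- A multiplicative nonarchimedean norm on an algebraic extension of `ℝ((x))` which extends the
`x`-adic one, together with the bounds on the coefficients of minimal polynomials given by the
Newton polygon. -/
structure IsAdicNorm {L : Type*} [Field L] [Algebra ℝ⸨X⸩ L] (N : L → ℝ) : Prop where
  map_zero : N 0 = 0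
  pos : ∀ a, a ≠ 0 → 0 < N a
  map_mul : ∀ a b, N (a * b) = N a * N b
  add_le_max : ∀ a b, N (a + b) ≤ max (N a) (N b)
  le_one_iff : ∀ k : ℝ⸨X⸩, N (algebraMap _ L k) ≤ 1 ↔ ∃ b : ℝ⟦X⟧, algebraMap ℝ⟦X⟧ ℝ⸨X⸩ b = k
  X_lt_one : N (algebraMap ℝ⸨X⸩ L (algebraMap ℝ⟦X⟧ ℝ⸨X⸩ X)) < 1
  coeff_le : ∀ a : L, ∀ i ≤ (minpoly ℝ⸨X⸩ a).natDegree,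
    N (algebraMap _ L ((minpoly ℝ⸨X⸩ a).coeff i)) ≤ N a ^ ((minpoly ℝ⸨X⸩ a).natDegree - i)
  coeff_zero : ∀ a : L,
    N (algebraMap _ L ((minpoly ℝ⸨X⸩ a).coeff 0)) = N a ^ (minpoly ℝ⸨X⸩ a).natDegree

-- The spectral norm works: it is multiplicative because ℝ((x)) is complete, and the coefficient
-- bounds come from its definition as a supremum of roots of coefficient norms of the minimal
-- polynomial.
open Valued in
theorem exists_isAdicNorm (L : Type*) [Field L] [Algebra ℝ⸨X⸩ L] [FiniteDimensional ℝ⸨X⸩ L] :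
    ∃ N : L → ℝ, IsAdicNorm N := by
  have hd : (Valued.v : Valuation ℝ⸨X⸩ (WithZero (Multiplicative ℤ))).IsRankOneDiscrete :=
    Valuation.IsRankOneDiscrete.mk' ((PowerSeries.idealX ℝ).valuation ℝ⸨X⸩)
  let hr : (Valued.v : Valuation ℝ⸨X⸩ (WithZero (Multiplicative ℤ))).RankOne :=
    -- The base 2 only normalises the norm; any base greater than 1 would do.
    Valuation.IsRankOneDiscrete.rankOne _ (e := 2) (by norm_num)
  refine ⟨spectralNorm ℝ⸨X⸩ L, ?_⟩
  constructor
  · exact spectralNorm_zero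
  · exact fun a ha => spectralNorm_zero_lt ha (Algebra.IsAlgebraic.isAlgebraic a)
  · exact fun a b => spectralAlgNorm_mul a b
  · exact fun a b => isNonarchimedean_spectralNorm a b
  · intro k
    rw [spectralNorm_extends, Valued.toNormedField.norm_le_one_iff, LaurentSeries.val_le_one_iff_eq_coe]
    rfl
  · rw [spectralNorm_extends, Valued.toNormedField.norm_lt_one_iff]
    have := LaurentSeries.valuation_X_pow ℝ 1
    rw [pow_one] at this
    erw [this]
    exact compareOfLessAndEq_eq_lt.mp rfl
  · intro a i hi
    rw [spectralNorm_extends]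
    rcases hi.eq_or_lt with h | h
    · subst h
      have : (minpoly ℝ⸨X⸩ a).Monic := minpoly.monic (Algebra.IsIntegral.isIntegral a)
      simp [this]
    · have h1 := le_ciSup (spectralValueTerms_bddAbove (minpoly ℝ⸨X⸩ a)) i
      rw [spectralValueTerms_of_lt_natDegree _ h] at h1
      change _ ≤ spectralNorm ℝ⸨X⸩ L a at h1
      have h2 := pow_le_pow_left₀ (by positivity) h1 ((minpoly ℝ⸨X⸩ a).natDegree - i)
      refine le_trans (le_of_eq ?_) h2
      rw [← Nat.cast_sub h.le, one_div, Real.rpow_inv_natCast_pow (norm_nonneg _) (by omega)]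
  · intro a
    rw [spectralNorm_extends, spectralNorm.spectralNorm_eq_norm_coeff_zero_rpow (K := ℝ⸨X⸩) L a, one_div,
      Real.rpow_inv_natCast_pow (norm_nonneg _)]
    exact (minpoly.natDegree_pos (Algebra.IsIntegral.isIntegral a)).ne'

namespace IsAdicNorm

variable {L : Type*} [Field L] [Algebra ℝ⸨X⸩ L] {N : L → ℝ} (hN : IsAdicNorm N)
include hN

theorem map_one : N 1 = 1 := by
  have h := hN.map_mul 1 1
  have := hN.pos 1 one_ne_zero
  rw [mul_one] at h
  nlinarith

theorem map_pow (a : L) (k : ℕ) : N (a ^ k) = N a ^ k := by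
  induction k with
  | zero => simp [hN.map_one]
  | succ k ih => rw [pow_succ, hN.map_mul, ih, pow_succ]

theorem map_inv (a : L) : N a⁻¹ = (N a)⁻¹ := by
  by_cases h : a = 0
  · simp [h, hN.map_zero]
  · have := hN.map_mul a a⁻¹
    rw [mul_inv_cancel₀ h, hN.map_one] at this
    exact eq_inv_of_mul_eq_one_right this.symm

theorem map_zpow (a : L) (k : ℤ) : N (a ^ k) = N a ^ k := by
  cases k with
  | ofNat k => simp [hN.map_pow]
  | negSucc k => rw [zpow_negSucc, zpow_negSucc, hN.map_inv, hN.map_pow]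

theorem map_div (a b : L) : N (a / b) = N a / N b := by
  rw [div_eq_mul_inv, hN.map_mul, hN.map_inv, div_eq_mul_inv]

theorem nonneg (a : L) : 0 ≤ N a := by
  by_cases h : a = 0
  · simp [h, hN.map_zero]
  · exact (hN.pos a h).le

theorem map_neg (a : L) : N (-a) = N a := by
  have h := hN.map_mul (-1) (-1)
  have := hN.nonneg (-1)
  rw [neg_mul_neg, one_mul, hN.map_one] at h
  have h1 : N (-1) = 1 := by nlinarith
  rw [← neg_one_mul, hN.map_mul, h1, one_mul]

theorem add_lt {a b : L} {c : ℝ} (ha : N a < c) (hb : N b < c) : N (a + b) < c :=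
  (hN.add_le_max a b).trans_lt (max_lt ha hb)

theorem add_eq_left {a b : L} (h : N b < N a) : N (a + b) = N a := by
  apply le_antisymm
  · exact (hN.add_le_max a b).trans (max_le le_rfl h.le)
  · by_contra! h1
    have := hN.add_lt h1 (b := -b) (by rwa [hN.map_neg])
    simp at this

section Base

variable [Algebra ℝ⟦X⟧ L] [IsScalarTower ℝ⟦X⟧ ℝ⸨X⸩ L]

theorem powerSeries_le_one (b : ℝ⟦X⟧) : N (algebraMap _ L b) ≤ 1 := by
  rw [IsScalarTower.algebraMap_apply ℝ⟦X⟧ ℝ⸨X⸩ L]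
  exact (hN.le_one_iff _).2 ⟨b, rfl⟩

theorem X_lt_one' : N (algebraMap ℝ⟦X⟧ L X) < 1 := by
  rw [IsScalarTower.algebraMap_apply ℝ⟦X⟧ ℝ⸨X⸩ L]
  exact hN.X_lt_one

theorem isUnit_eq_one {b : ℝ⟦X⟧} (hb : IsUnit b) : N (algebraMap _ L b) = 1 := by
  obtain ⟨c, hc⟩ := hb.exists_right_inv
  have h := congrArg (fun t => N (algebraMap ℝ⟦X⟧ L t)) hc
  simp only [_root_.map_mul, _root_.map_one, hN.map_mul, hN.map_one] at h
  have h1 := hN.powerSeries_le_one b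
  have h2 := hN.powerSeries_le_one c
  have h3 := hN.nonneg (algebraMap ℝ⟦X⟧ L b)
  nlinarith

theorem real_eq_one {r : ℝ} (hr : r ≠ 0) : N (algebraMap ℝ⟦X⟧ L (C r)) = 1 :=
  hN.isUnit_eq_one (by simpa [PowerSeries.isUnit_iff_constantCoeff] using hr)

theorem lt_one_iff {b : ℝ⟦X⟧} : N (algebraMap _ L b) < 1 ↔ X ∣ b := by
  constructor
  · intro h
    by_contra h1
    rw [PowerSeries.X_dvd_iff] at h1
    exact h.ne (hN.isUnit_eq_one (PowerSeries.isUnit_iff_constantCoeff.2 (by simpa using h1)))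
  · rintro ⟨c, rfl⟩
    rw [_root_.map_mul, hN.map_mul]
    have h1 := hN.powerSeries_le_one c
    have h2 := hN.nonneg (algebraMap ℝ⟦X⟧ L c)
    have h3 := hN.X_lt_one'
    have h4 := hN.nonneg (algebraMap ℝ⟦X⟧ L X)
    nlinarith

theorem X_pos : 0 < N (algebraMap ℝ⟦X⟧ L X) := by
  apply hN.pos
  rw [IsScalarTower.algebraMap_apply ℝ⟦X⟧ ℝ⸨X⸩ L]
  simp

/-- Norms of nonzero elements of ℝ⟦x⟧ are powers of the norm of `X`, so a strict inequality gains a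
whole extra factor `X`. -/
theorem X_pow_dvd {b : ℝ⟦X⟧} {e : ℕ} (h : N (algebraMap _ L b) < N (algebraMap ℝ⟦X⟧ L X) ^ e) :
    X ^ (e + 1) ∣ b := by
  induction e generalizing b with
  | zero => simpa using hN.lt_one_iff.1 (by simpa using h)
  | succ e ih =>
    have h4 := hN.X_pos
    obtain ⟨c, rfl⟩ := hN.lt_one_iff.1 (h.trans_le (pow_le_one₀ h4.le hN.X_lt_one'.le))
    rw [_root_.map_mul, hN.map_mul, pow_succ'] at h
    rw [pow_succ']
    exact mul_dvd_mul_left _ (ih (lt_of_mul_lt_mul_left h h4.le))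

end Base

end IsAdicNorm

end

/-! ### Hensel's lemma and evaluation of power series at roots of distinguished polynomials. -/

section

open LaurentSeries PowerSeries

instance PowerSeries.isAdicComplete_maximalIdeal (k : Type*) [Field k] :
    IsAdicComplete (IsLocalRing.maximalIdeal k⟦X⟧) k⟦X⟧ := by
  rw [PowerSeries.maximalIdeal_eq_span_X]
  infer_instance

/-- Hensel's lemma for T² - u at the approximate root 1, where the derivative 2 is a unit. -/
theorem PowerSeries.isSquare_of_constantCoeff_eq_one {R : Type*} [CommRing R] [Algebra ℚ R]
    {u : R⟦X⟧} (hu : constantCoeff u = 1) : IsSquare u := by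
  have h2 : IsUnit (2 : R) := by
    have : IsUnit (algebraMap ℚ R 2) := (IsUnit.mk0 (2 : ℚ) two_ne_zero).map _
    rwa [map_ofNat] at this
  obtain ⟨a, ha, -⟩ := HenselianRing.is_henselian (I := Ideal.span {(X : R⟦X⟧)})
    (Polynomial.X ^ 2 - Polynomial.C u) (Polynomial.monic_X_pow_sub_C u two_ne_zero) 1
    (by
      simp only [Polynomial.eval_sub, Polynomial.eval_pow, Polynomial.eval_X, Polynomial.eval_C]
      rw [Ideal.mem_span_singleton, PowerSeries.X_dvd_iff]
      simp [hu])
    (by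
      simp only [Polynomial.derivative_sub, Polynomial.derivative_X_pow, Polynomial.derivative_C]
      have : IsUnit (C (2 : R)) := h2.map _
      have := this.map (Ideal.Quotient.mk (Ideal.span {(X : R⟦X⟧)}))
      rw [map_ofNat] at this
      simpa using this)
  refine ⟨a, ?_⟩
  simp only [Polynomial.IsRoot.def, Polynomial.eval_sub, Polynomial.eval_pow, Polynomial.eval_X,
    Polynomial.eval_C] at ha
  rw [← pow_two]
  exact (sub_eq_zero.1 ha).symm

theorem PowerSeries.isSquare_of_isSquare_constantCoeff {R : Type*} [CommRing R] [Algebra ℚ R]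
    {u : R⟦X⟧} (h : IsSquare (constantCoeff u)) (h1 : IsUnit (constantCoeff u)) : IsSquare u := by
  obtain ⟨v, hv⟩ := h1.exists_right_inv
  have h2 : IsSquare (C v * u) := isSquare_of_constantCoeff_eq_one (by simp [mul_comm v, hv])
  have h3 : u = C (constantCoeff u) * (C v * u) := by
    rw [← mul_assoc, ← _root_.map_mul, hv, _root_.map_one, one_mul]
  rw [h3]
  exact (h.map C).mul h2

theorem PowerSeries.isSquare_of_pos {u : ℝ⟦X⟧} (h : 0 < constantCoeff u) : IsSquare u :=
  isSquare_of_isSquare_constantCoeff ⟨√(constantCoeff u), (Real.mul_self_sqrt h.le).symm⟩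
    (IsUnit.mk0 _ h.ne')

theorem PowerSeries.isSquare_of_pos₂ {u : ℝ⟦X⟧⟦X⟧} (h : 0 < constantCoeff (constantCoeff u)) :
    IsSquare u :=
  isSquare_of_isSquare_constantCoeff (isSquare_of_pos h)
    (PowerSeries.isUnit_iff_constantCoeff.2 (IsUnit.mk0 _ h.ne'))

/-- Weierstrass division identifies R[X]/(q) with R⟦X⟧/(q). Power series can therefore be evaluated
at a root of q without any topology on S, and the kernel is controlled by that of polynomial
evaluation. -/
theorem Polynomial.IsDistinguishedAt.exists_ringHom {R S : Type*} [CommRing R] [CommRing S]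
    [Algebra R S] {I : Ideal R} [IsAdicComplete I R] {q : Polynomial R}
    (hq : q.IsDistinguishedAt I) {t : S} (ht : Polynomial.aeval t q = 0) :
    ∃ φ : R⟦X⟧ →+* S, (∀ p : Polynomial R, φ p = Polynomial.aeval t p) ∧
      ((∀ p : Polynomial R, Polynomial.aeval t p = 0 → q ∣ p) →
        ∀ a, φ a = 0 → (q : R⟦X⟧) ∣ a) := by
  let ψ : (Polynomial R ⧸ Ideal.span {q}) →ₐ[R] S := Ideal.Quotient.liftₐ _ (Polynomial.aeval t)
    (fun a ha => by
      obtain ⟨b, rfl⟩ := Ideal.mem_span_singleton.1 ha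
      simp [ht])
  have hψ (p : Polynomial R) : ψ (Ideal.Quotient.mk _ p) = Polynomial.aeval t p := rfl
  have key : ∀ p : Polynomial R, hq.algEquivQuotient.symm (Ideal.Quotient.mk _ (p : R⟦X⟧)) =
      Ideal.Quotient.mk _ p := by
    intro p
    rw [AlgEquiv.symm_apply_eq]
    simp
  refine ⟨ψ.toRingHom.comp (hq.algEquivQuotient.symm.toRingEquiv.toRingHom.comp (Ideal.Quotient.mk _)),
    fun p => ?_, fun h a ha => ?_⟩
  · exact (congrArg ψ (key p)).trans (hψ p)
  · obtain ⟨p, hp⟩ := Ideal.Quotient.mk_surjective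
      (hq.algEquivQuotient.symm (Ideal.Quotient.mk (Ideal.span {(q : R⟦X⟧)}) a))
    have h1 : ψ (Ideal.Quotient.mk _ p) = 0 := by rw [hp]; exact ha
    have h2 : Ideal.Quotient.mk (Ideal.span {q}) p = 0 :=
      Ideal.Quotient.eq_zero_iff_mem.2 (Ideal.mem_span_singleton.2 (h p (by rw [← hψ, h1])))
    rw [h2, eq_comm, EmbeddingLike.map_eq_zero_iff, Ideal.Quotient.eq_zero_iff_mem,
      Ideal.mem_span_singleton] at hp
    exact hp

namespace IsAdicNorm

variable {L : Type*} [Field L] [Algebra ℝ⸨X⸩ L] [FiniteDimensional ℝ⸨X⸩ L] {N : L → ℝ}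
  (hN : IsAdicNorm N) [Algebra ℝ⟦X⟧ L] [IsScalarTower ℝ⟦X⟧ ℝ⸨X⸩ L]
include hN

theorem isIntegral {a : L} (ha : N a ≤ 1) : IsIntegral ℝ⟦X⟧ a := by
  have hm : (minpoly ℝ⸨X⸩ a).Monic := minpoly.monic (Algebra.IsIntegral.isIntegral a)
  have : minpoly ℝ⸨X⸩ a ∈ Polynomial.lifts (algebraMap ℝ⟦X⟧ ℝ⸨X⸩) := by
    rw [Polynomial.lifts_iff_coeff_lifts]
    intro i
    rw [Set.mem_range, ← hN.le_one_iff]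
    rcases le_or_gt i (minpoly ℝ⸨X⸩ a).natDegree with h | h
    · exact (hN.coeff_le a i h).trans (pow_le_one₀ (hN.nonneg a) ha)
    · simp [Polynomial.coeff_eq_zero_of_natDegree_lt h, hN.map_zero]
  obtain ⟨q, hq, -, hqm⟩ := Polynomial.lifts_and_natDegree_eq_and_monic this hm
  refine ⟨q, hqm, ?_⟩
  have h := minpoly.aeval ℝ⸨X⸩ a
  rwa [← hq, Polynomial.aeval_map_algebraMap] at h

theorem isDistinguishedAt {a : L} (ha : N a < 1) :
    (minpoly ℝ⟦X⟧ a).IsDistinguishedAt (IsLocalRing.maximalIdeal ℝ⟦X⟧) := by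
  have hi := hN.isIntegral ha.le
  have hmap := minpoly.isIntegrallyClosed_eq_field_fractions' ℝ⸨X⸩ hi
  have hm := minpoly.monic hi
  refine ⟨⟨fun {i} h => ?_⟩, hm⟩
  rw [maximalIdeal_eq_span_X, Ideal.mem_span_singleton, ← hN.lt_one_iff,
    IsScalarTower.algebraMap_apply ℝ⟦X⟧ ℝ⸨X⸩ L, ← Polynomial.coeff_map, ← hmap]
  have hd : (minpoly ℝ⸨X⸩ a).natDegree = (minpoly ℝ⟦X⟧ a).natDegree := by
    rw [hmap, hm.natDegree_map]
  refine (hN.coeff_le a i (by omega)).trans_lt (pow_lt_one₀ (hN.nonneg a) ha (by omega))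

/-- The minimal polynomial of t is distinguished, so the power series √(1 + X) can be evaluated at
t. -/
theorem isSquare_one_add {t : L} (ht : N t < 1) : IsSquare (1 + t) := by
  obtain ⟨φ, hφ, -⟩ := (hN.isDistinguishedAt ht).exists_ringHom (minpoly.aeval ℝ⟦X⟧ t)
  have h := hφ (1 + Polynomial.X)
  have h1 : IsSquare (1 + X : ℝ⟦X⟧⟦X⟧) := isSquare_of_pos₂ (by simp)
  have h2 := h1.map φ
  simp only [Polynomial.coe_add, Polynomial.coe_one, Polynomial.coe_X, map_add, _root_.map_one,
    Polynomial.aeval_X] at h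
  rwa [map_add, _root_.map_one, h] at h2

theorem isSquare_real_add {t : L} {r : ℝ} (hr : 0 < r) (ht : N t < 1) :
    IsSquare (algebraMap ℝ⟦X⟧ L (C r) + t) := by
  have h0 : algebraMap ℝ⟦X⟧ L (C r) ≠ 0 := by
    intro h
    have := hN.real_eq_one hr.ne'
    rw [h, hN.map_zero] at this
    exact zero_ne_one this
  have h1 : algebraMap ℝ⟦X⟧ L (C r) + t =
      algebraMap ℝ⟦X⟧ L (C r) * (1 + t / algebraMap ℝ⟦X⟧ L (C r)) := by
    field_simp
  rw [h1]
  refine IsSquare.mul ?_ (hN.isSquare_one_add ?_)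
  · exact IsSquare.map (algebraMap ℝ⟦X⟧ L) (isSquare_of_pos (by simpa using hr))
  · rwa [hN.map_div, hN.real_eq_one hr.ne', div_one]

end IsAdicNorm

end

/-! ### Positive cones; residue field and value group of a finite extension of ℝ((x)). -/

section

open LaurentSeries PowerSeries

/-- The set of positive elements of a total ring ordering. -/
structure IsPosCone {R : Type*} [CommRing R] (pos : R → Prop) : Prop where
  add : ∀ {a b}, pos a → pos b → pos (a + b)
  mul : ∀ {a b}, pos a → pos b → pos (a * b)
  zero : ¬ pos 0
  total : ∀ {a}, a ≠ 0 → pos a ∨ pos (-a)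

namespace IsAdicNorm

variable {L : Type*} [Field L] [Algebra ℝ⸨X⸩ L] [FiniteDimensional ℝ⸨X⸩ L] {N : L → ℝ}
  (hN : IsAdicNorm N) [Algebra ℝ⟦X⟧ L] [IsScalarTower ℝ⟦X⟧ ℝ⸨X⸩ L]
include hN

omit [FiniteDimensional ℝ⸨X⸩ L] in
theorem aeval_le_one {a : L} (ha : N a ≤ 1) (p : Polynomial ℝ⟦X⟧) :
    N (Polynomial.aeval a p) ≤ 1 := by
  induction p using Polynomial.induction_on' with
  | add p q hp hq =>
    rw [map_add]
    exact (hN.add_le_max _ _).trans (max_le hp hq)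
  | monomial n b =>
    rw [Polynomial.aeval_monomial, hN.map_mul, hN.map_pow]
    exact mul_le_one₀ (hN.powerSeries_le_one b) (pow_nonneg (hN.nonneg a) _)
      (pow_le_one₀ (hN.nonneg a) ha)

/-- Reducing the minimal polynomial of a modulo x gives a real polynomial that is small at a; by
multiplicativity of the norm, one of its irreducible factors is small too. -/
theorem exists_irreducible_eval₂_lt_one {a : L} (ha : N a ≤ 1) :
    ∃ p : Polynomial ℝ, Irreducible p ∧
      N (p.eval₂ ((algebraMap ℝ⟦X⟧ L).comp C) a) < 1 := by
  have hi := hN.isIntegral ha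
  have hm := minpoly.monic hi
  set μ := minpoly ℝ⟦X⟧ a with hμ
  set ι : ℝ →+* L := (algebraMap ℝ⟦X⟧ L).comp C with hι
  have h0 : N ((μ.map constantCoeff).eval₂ ι a) < 1 := by
    have h1 : Polynomial.C X ∣ (μ.map constantCoeff).map C - μ := by
      rw [Polynomial.C_dvd_iff_dvd_coeff]
      intro i
      rw [PowerSeries.X_dvd_iff]
      simp
    obtain ⟨q, hq⟩ := h1
    have h2 := congrArg (Polynomial.aeval a) hq
    rw [map_sub, minpoly.aeval, sub_zero, _root_.map_mul, Polynomial.aeval_C] at h2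
    have h3 : (μ.map constantCoeff).eval₂ ι a =
        Polynomial.aeval a ((μ.map constantCoeff).map C) := by
      rw [Polynomial.aeval_def, Polynomial.eval₂_map, Polynomial.eval₂_map, Polynomial.eval₂_map]
    rw [h3, h2, hN.map_mul]
    have h4 := hN.aeval_le_one ha q
    have h5 := hN.nonneg (Polynomial.aeval a q)
    have h6 := hN.X_pos
    have h7 := hN.X_lt_one'
    nlinarith
  have hne : μ.map constantCoeff ≠ 0 := (hm.map _).ne_zero
  generalize μ.map constantCoeff = q at h0 hne
  induction q using WfDvdMonoid.induction_on_irreducible with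
  | zero => exact absurd rfl hne
  | unit u hu =>
    obtain ⟨r, hr, rfl⟩ := Polynomial.isUnit_iff.1 hu
    rw [Polynomial.eval₂_C, hι, RingHom.comp_apply, hN.real_eq_one hr.ne_zero] at h0
    exact absurd h0 (lt_irrefl _)
  | mul q i hq hi' ih =>
    rw [Polynomial.eval₂_mul, hN.map_mul] at h0
    by_cases h1 : N (i.eval₂ ι a) < 1
    · exact ⟨i, hi', h1⟩
    · refine ih ?_ hq
      have h5 := hN.nonneg (q.eval₂ ι a)
      nlinarith

/-- A real irreducible polynomial that is small at a is linear, which gives r, or quadratic. A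
quadratic one makes (a - r)² + s² small with s ≠ 0, and then -(a - r)² is a square by Hensel, hence
so is -1. -/
theorem exists_residue (h1 : ¬ IsSquare (-1 : L)) {a : L} (ha : N a ≤ 1) :
    ∃ r : ℝ, N (a - algebraMap ℝ⟦X⟧ L (C r)) < 1 := by
  obtain ⟨p, hp, hlt⟩ := hN.exists_irreducible_eval₂_lt_one ha
  set ι : ℝ →+* L := (algebraMap ℝ⟦X⟧ L).comp C with hι
  have hassoc : ∀ q : Polynomial ℝ, ¬ IsUnit q → q ∣ p → N (q.eval₂ ι a) < 1 := by
    intro q hq hqp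
    obtain ⟨c, rfl⟩ := hqp
    have hc := (hp.isUnit_or_isUnit rfl).resolve_left hq
    obtain ⟨r, hr, rfl⟩ := Polynomial.isUnit_iff.1 hc
    rwa [Polynomial.eval₂_mul, hN.map_mul, Polynomial.eval₂_C, hι, RingHom.comp_apply,
      hN.real_eq_one hr.ne_zero, mul_one] at hlt
  obtain ⟨z, hz⟩ := IsAlgClosed.exists_aeval_eq_zero ℂ p (Polynomial.degree_pos_of_irreducible hp).ne'
  by_cases hzi : z.im = 0
  · refine ⟨z.re, ?_⟩
    have hz' : z = algebraMap ℝ ℂ z.re := by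
      apply Complex.ext <;> simp [hzi]
    rw [hz', Polynomial.aeval_algebraMap_apply, _root_.map_eq_zero] at hz
    have := hassoc (Polynomial.X - Polynomial.C z.re)
      (Polynomial.not_isUnit_X_sub_C _) (Polynomial.dvd_iff_isRoot.2 hz)
    simpa [hι] using this
  · exfalso
    have hd := p.quadratic_dvd_of_aeval_eq_zero_im_ne_zero hz hzi
    have := hassoc _ (fun hu => by
      have := Polynomial.natDegree_eq_zero_of_isUnit hu
      have h2 : (Polynomial.X ^ 2 - Polynomial.C (2 * z.re) * Polynomial.X
        + Polynomial.C (‖z‖ ^ 2) : Polynomial ℝ).natDegree = 2 := by compute_degree!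
      omega) hd
    set t := Polynomial.eval₂ ι a (Polynomial.X ^ 2 - Polynomial.C (2 * z.re) * Polynomial.X
        + Polynomial.C (‖z‖ ^ 2)) with ht
    have ht' : t = (a - ι z.re) ^ 2 + ι (z.im ^ 2) := by
      have : ‖z‖ ^ 2 = z.re ^ 2 + z.im ^ 2 := by
        rw [← Complex.normSq_eq_norm_sq, Complex.normSq_apply]; ring
      rw [ht, this]
      simp only [Polynomial.eval₂_add, Polynomial.eval₂_sub, Polynomial.eval₂_mul,
        Polynomial.eval₂_C, Polynomial.eval₂_X_pow, Polynomial.eval₂_X]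
      simp only [map_add, _root_.map_mul, _root_.map_pow, map_ofNat]
      ring
    have him : 0 < z.im ^ 2 := by positivity
    obtain ⟨s, hs⟩ := hN.isSquare_real_add him (t := -t) (by rwa [hN.map_neg])
    have hs' : s * s = -(a - ι z.re) ^ 2 := by
      rw [← hs, ht']
      simp [hι]
    have hs0 : s ≠ 0 := by
      rintro rfl
      have h3 := hN.add_eq_left (a := algebraMap ℝ⟦X⟧ L (C (z.im ^ 2))) (b := -t)
        (by rwa [hN.map_neg, hN.real_eq_one him.ne'])
      rw [hs, hN.real_eq_one him.ne', mul_zero, hN.map_zero] at h3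
      exact zero_ne_one h3
    have ha0 : a - ι z.re ≠ 0 := by
      intro h
      rw [h] at hs'
      simp at hs'
      exact hs0 hs'
    refine h1 ⟨s / (a - ι z.re), ?_⟩
    rw [div_mul_div_comm, hs', pow_two, neg_div, div_self (mul_self_ne_zero.2 ha0)]

omit [FiniteDimensional ℝ⸨X⸩ L] in
theorem exists_eq_zpow {k : ℝ⸨X⸩} (hk : k ≠ 0) :
    ∃ j : ℤ, N (algebraMap _ L k) = N (algebraMap ℝ⟦X⟧ L X) ^ j := by
  have key : ∀ b : ℝ⟦X⟧, b ≠ 0 → ∃ j : ℕ, N (algebraMap _ L b) = N (algebraMap ℝ⟦X⟧ L X) ^ j := by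
    intro b hb
    obtain ⟨j, u, rfl⟩ := IsDiscreteValuationRing.eq_unit_mul_pow_irreducible hb
      PowerSeries.X_irreducible
    refine ⟨j, ?_⟩
    rw [_root_.map_mul, hN.map_mul, hN.isUnit_eq_one u.isUnit, one_mul, _root_.map_pow, hN.map_pow]
  obtain ⟨b, c, hc, rfl⟩ := IsFractionRing.div_surjective (A := ℝ⟦X⟧) k
  have hc0 := nonZeroDivisors.ne_zero hc
  have hb0 : b ≠ 0 := by rintro rfl; simp at hk
  obtain ⟨i, hi⟩ := key b hb0
  obtain ⟨j, hj⟩ := key c hc0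
  refine ⟨i - j, ?_⟩
  rw [map_div₀, ← IsScalarTower.algebraMap_apply, ← IsScalarTower.algebraMap_apply, hN.map_div,
    hi, hj, zpow_sub₀ hN.X_pos.ne', zpow_natCast, zpow_natCast]

/-- The norm of a, raised to its degree, is the norm of the constant coefficient of its minimal
polynomial. So with n = [L : ℝ((x))] all N(a)^n are integral powers of N(x), and the exponents form
a cyclic subgroup of ℤ. -/
theorem exists_uniformizer :
    ∃ ϖ : L, ϖ ≠ 0 ∧ N ϖ < 1 ∧ ∀ a : L, a ≠ 0 → ∃ k : ℤ, N a = N ϖ ^ k := by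
  set n := Module.finrank ℝ⸨X⸩ L with hn
  have hn0 : n ≠ 0 := (Module.finrank_pos).ne'
  set c := N (algebraMap ℝ⟦X⟧ L X) with hc
  have hc0 : 0 < c := hN.X_pos
  have hc1 : c < 1 := hN.X_lt_one'
  have h1 : ∀ a : L, a ≠ 0 → ∃ j : ℤ, N a ^ n = c ^ j := by
    intro a ha
    have hi : IsIntegral ℝ⸨X⸩ a := Algebra.IsIntegral.isIntegral a
    obtain ⟨j, hj⟩ := hN.exists_eq_zpow (minpoly.coeff_zero_ne_zero hi ha)
    obtain ⟨d, hd⟩ := minpoly.degree_dvd hi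
    refine ⟨j * d, ?_⟩
    rw [hn, hd, pow_mul, ← hN.coeff_zero, hj, zpow_mul, zpow_natCast]
  let H : AddSubgroup ℤ :=
    { carrier := {j | ∃ a : L, a ≠ 0 ∧ N a ^ n = c ^ j}
      zero_mem' := ⟨1, one_ne_zero, by simp [hN.map_one]⟩
      add_mem' := by
        rintro i j ⟨a, ha, hi⟩ ⟨b, hb, hj⟩
        exact ⟨a * b, mul_ne_zero ha hb, by rw [hN.map_mul, mul_pow, hi, hj, zpow_add₀ hc0.ne']⟩
      neg_mem' := by
        rintro i ⟨a, ha, hi⟩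
        exact ⟨a⁻¹, inv_ne_zero ha, by rw [hN.map_inv, inv_pow, hi, zpow_neg]⟩ }
  obtain ⟨h, hh⟩ := Int.subgroup_cyclic H
  have hmem : ∀ j : ℤ, (∃ a : L, a ≠ 0 ∧ N a ^ n = c ^ j) ↔ h ∣ j := by
    intro j
    change j ∈ H ↔ _
    rw [hh, AddSubgroup.mem_closure_singleton]
    simp only [smul_eq_mul, dvd_def, mul_comm h, eq_comm]
  have hh0 : h ≠ 0 := by
    rintro rfl
    have := (hmem n).1 ⟨algebraMap ℝ⟦X⟧ L X, fun h0 => by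
      rw [hc, h0, hN.map_zero] at hc0; exact lt_irrefl _ hc0, by simp [← hc]⟩
    rw [zero_dvd_iff] at this
    exact hn0 (by exact_mod_cast this)
  -- The absolute value selects the positive generator, so that the norm of ϖ is less than 1.
  obtain ⟨ϖ, hϖ, hϖn⟩ := (hmem |h|).2 (by simp)
  refine ⟨ϖ, hϖ, ?_, fun a ha => ?_⟩
  · by_contra! h2
    have h3 : c ^ |h| < 1 := by
      obtain ⟨m, hm⟩ := Int.eq_ofNat_of_zero_le (abs_nonneg h)
      rw [hm, zpow_natCast]
      refine pow_lt_one₀ hc0.le hc1 ?_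
      rintro rfl
      simp at hm
      exact hh0 hm
    rw [← hϖn] at h3
    exact absurd (one_le_pow₀ h2) (not_le.2 h3)
  · obtain ⟨j, hj⟩ := h1 a ha
    obtain ⟨k, rfl⟩ : |h| ∣ j := by rw [abs_dvd]; exact (hmem j).1 ⟨a, ha, hj⟩
    refine ⟨k, ?_⟩
    rw [← pow_left_inj₀ (hN.nonneg a) (zpow_nonneg (hN.nonneg _) _) hn0, hj, zpow_mul, ← hϖn,
      ← zpow_natCast, ← zpow_natCast, ← zpow_mul, ← zpow_mul, mul_comm]

end IsAdicNorm

end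

/-! ### Orderings of a finite extension of ℝ((x)). -/

section

open LaurentSeries PowerSeries

namespace IsAdicNorm

variable {L : Type*} [Field L] [Algebra ℝ⸨X⸩ L] [FiniteDimensional ℝ⸨X⸩ L] {N : L → ℝ}
  (hN : IsAdicNorm N) [Algebra ℝ⟦X⟧ L] [IsScalarTower ℝ⟦X⟧ ℝ⸨X⸩ L]
include hN

theorem exists_eq_zpow_mul_add (h1 : ¬ IsSquare (-1 : L)) {ϖ : L} (h0 : ϖ ≠ 0)
    (hgen : ∀ a : L, a ≠ 0 → ∃ k : ℤ, N a = N ϖ ^ k) {a : L} (ha : a ≠ 0) :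
    ∃ (k : ℤ) (r : ℝ) (t : L), r ≠ 0 ∧ N t < 1 ∧ a = ϖ ^ k * (algebraMap ℝ⟦X⟧ L (C r) + t) := by
  obtain ⟨k, hk⟩ := hgen a ha
  have hk0 : ϖ ^ k ≠ 0 := zpow_ne_zero k h0
  have hb : N (a / ϖ ^ k) = 1 := by
    rw [hN.map_div, hN.map_zpow, hk, div_self (zpow_ne_zero _ (hN.pos _ h0).ne')]
  obtain ⟨r, hr⟩ := hN.exists_residue h1 hb.le
  refine ⟨k, r, _, ?_, hr, ?_⟩
  · rintro rfl
    simp [hb] at hr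
  · field_simp
    ring

omit [FiniteDimensional ℝ⸨X⸩ L] [IsScalarTower ℝ⟦X⟧ ℝ⸨X⸩ L] in
theorem exists_add_eq {ϖ : L} (h0 : ϖ ≠ 0) (hϖ : N ϖ < 1) {k j : ℤ} (hkj : k ≤ j) {r r' : ℝ}
    (hr : 0 < r) (hr' : 0 < r') {t t' : L} (ht : N t < 1) (ht' : N t' < 1)
    (h1 : N (algebraMap ℝ⟦X⟧ L (C r') + t') ≤ 1) :
    ∃ (s : ℝ) (u : L), 0 < s ∧ N u < 1 ∧
      ϖ ^ k * (algebraMap ℝ⟦X⟧ L (C r) + t) + ϖ ^ j * (algebraMap ℝ⟦X⟧ L (C r') + t') =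
        ϖ ^ k * (algebraMap ℝ⟦X⟧ L (C s) + u) := by
  rcases hkj.eq_or_lt with rfl | hlt
  · refine ⟨r + r', t + t', add_pos hr hr', hN.add_lt ht ht', ?_⟩
    simp only [map_add]
    ring
  · refine ⟨r, t + ϖ ^ (j - k) * (algebraMap ℝ⟦X⟧ L (C r') + t'), hr, hN.add_lt ht ?_, ?_⟩
    · obtain ⟨d, hd⟩ := Int.eq_ofNat_of_zero_le (sub_nonneg.2 hkj)
      rw [hd, zpow_natCast, hN.map_mul, hN.map_pow]
      have h2 : N ϖ ^ d < 1 := pow_lt_one₀ (hN.nonneg ϖ) hϖ (by omega)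
      have h3 := hN.nonneg (algebraMap ℝ⟦X⟧ L (C r') + t')
      have h4 : 0 ≤ N ϖ ^ d := pow_nonneg (hN.nonneg ϖ) d
      nlinarith
    · have : ϖ ^ j = ϖ ^ k * ϖ ^ (j - k) := by rw [← zpow_add₀ h0]; congr 1; ring
      rw [this]
      ring

/-- Take the sign of the leading coefficient in powers of ϖ. Using -ϖ instead flips the sign of
exactly the elements of odd value. -/
theorem exists_isPosCone (h1 : ¬ IsSquare (-1 : L)) {ϖ : L} (h0 : ϖ ≠ 0) (hϖ : N ϖ < 1)
    (hgen : ∀ a : L, a ≠ 0 → ∃ k : ℤ, N a = N ϖ ^ k) :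
    ∃ pos : L → Prop, IsPosCone pos ∧ ∀ (k : ℤ) (r : ℝ) (t : L), 0 < r → N t < 1 →
      pos (ϖ ^ k * (algebraMap ℝ⟦X⟧ L (C r) + t)) := by
  have hle : ∀ (r : ℝ) (t : L), N t < 1 → N (algebraMap ℝ⟦X⟧ L (C r) + t) ≤ 1 := fun r t ht =>
    (hN.add_le_max _ _).trans (max_le (hN.powerSeries_le_one _) ht.le)
  refine ⟨fun a => ∃ (k : ℤ) (r : ℝ) (t : L), 0 < r ∧ N t < 1 ∧
    a = ϖ ^ k * (algebraMap ℝ⟦X⟧ L (C r) + t), ⟨?_, ?_, ?_, ?_⟩,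
    fun k r t hr ht => ⟨k, r, t, hr, ht, rfl⟩⟩
  · rintro _ _ ⟨k, r, t, hr, ht, rfl⟩ ⟨j, r', t', hr', ht', rfl⟩
    rcases le_total k j with h | h
    · obtain ⟨s, u, hs, hu, he⟩ := hN.exists_add_eq h0 hϖ h hr hr' ht ht' (hle _ _ ht')
      exact ⟨k, s, u, hs, hu, he⟩
    · obtain ⟨s, u, hs, hu, he⟩ := hN.exists_add_eq h0 hϖ h hr' hr ht' ht (hle _ _ ht)
      exact ⟨j, s, u, hs, hu, by rw [add_comm, he]⟩
  · rintro _ _ ⟨k, r, t, hr, ht, rfl⟩ ⟨j, r', t', hr', ht', rfl⟩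
    refine ⟨k + j, r * r', algebraMap ℝ⟦X⟧ L (C r) * t' + t * (algebraMap ℝ⟦X⟧ L (C r') + t'),
      mul_pos hr hr', hN.add_lt ?_ ?_, ?_⟩
    · rwa [hN.map_mul, hN.real_eq_one hr.ne', one_mul]
    · rw [hN.map_mul]
      have := hle r' t' ht'
      have h2 := hN.nonneg (algebraMap ℝ⟦X⟧ L (C r') + t')
      have h3 := hN.nonneg t
      nlinarith
    · rw [zpow_add₀ h0]
      simp only [_root_.map_mul]
      ring
  · rintro ⟨k, r, t, hr, ht, h⟩
    have h2 := (mul_eq_zero.1 h.symm).resolve_left (zpow_ne_zero k h0)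
    have h3 := hN.add_eq_left (a := algebraMap ℝ⟦X⟧ L (C r)) (b := t)
      (by rwa [hN.real_eq_one hr.ne'])
    rw [h2, hN.map_zero, hN.real_eq_one hr.ne'] at h3
    exact zero_ne_one h3
  · intro a ha
    obtain ⟨k, r, t, hr, ht, rfl⟩ := hN.exists_eq_zpow_mul_add h1 h0 hgen ha
    rcases lt_or_gt_of_ne hr with h | h
    · right
      refine ⟨k, -r, -t, by linarith, by rwa [hN.map_neg], ?_⟩
      simp only [_root_.map_neg]
      ring
    · exact Or.inl ⟨k, r, t, h, ht, rfl⟩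

/-- If neither `θ` nor `x ^ (2 * n) - θ` is minus a square, then both are positive for some ordering,
or `θ` dominates `x ^ (2 * n)`. -/
theorem exists_isPosCone_or_lt (h1 : ¬ IsSquare (-1 : L)) {n : ℕ} {θ : L}
    (hθ0 : θ ≠ 0) (hw0 : algebraMap ℝ⟦X⟧ L X ^ (2 * n) - θ ≠ 0)
    (hθ : ¬ IsSquare (-θ)) (hw : ¬ IsSquare (-(algebraMap ℝ⟦X⟧ L X ^ (2 * n) - θ))) :
    (∃ pos : L → Prop, IsPosCone pos ∧ pos θ ∧ pos (algebraMap ℝ⟦X⟧ L X ^ (2 * n) - θ)) ∨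
      N (algebraMap ℝ⟦X⟧ L X) ^ (2 * n) < N θ := by
  obtain ⟨ϖ, h0, hϖ, hgen⟩ := hN.exists_uniformizer
  set w := algebraMap ℝ⟦X⟧ L X ^ (2 * n) - θ with hwdef
  have hgen' : ∀ a : L, a ≠ 0 → ∃ k : ℤ, N a = N (-ϖ) ^ k := by simpa only [hN.map_neg] using hgen
  -- At even value, a negative leading coefficient would make the negative of the element a square
  -- by Hensel.
  have even_pos : ∀ (j : ℤ) (r : ℝ) (t : L), r ≠ 0 → N t < 1 →
      ¬ IsSquare (-(ϖ ^ (j + j) * (algebraMap ℝ⟦X⟧ L (C r) + t))) → 0 < r := by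
    intro j r t hr ht hsq
    by_contra! hr'
    apply hsq
    have h2 := hN.isSquare_real_add (r := -r) (t := -t) (by
      rcases hr'.lt_or_eq with h | h
      · linarith
      · exact absurd h hr) (by rwa [hN.map_neg])
    have h3 : -(ϖ ^ (j + j) * (algebraMap ℝ⟦X⟧ L (C r) + t)) =
        (ϖ ^ j * ϖ ^ j) * (algebraMap ℝ⟦X⟧ L (C (-r)) + -t) := by
      rw [zpow_add₀ h0]
      simp only [_root_.map_neg]
      ring
    rw [h3]
    exact IsSquare.mul ⟨_, rfl⟩ h2
  -- An a of even value is positive whichever sign ϖ has; that sign can thus be chosen to make b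
  -- positive.
  have key : ∀ a b : L, a ≠ 0 → b ≠ 0 → ¬ IsSquare (-a) → ¬ IsSquare (-b) →
      (∃ j : ℤ, N a = N ϖ ^ (j + j)) → ∃ pos : L → Prop, IsPosCone pos ∧ pos a ∧ pos b := by
    rintro a b ha hb ha' hb' ⟨j, hj⟩
    obtain ⟨k, r, t, hr, ht, rfl⟩ := hN.exists_eq_zpow_mul_add h1 h0 hgen ha
    have hk : k = j + j := by
      have h2 := hN.add_eq_left (a := algebraMap ℝ⟦X⟧ L (C r)) (b := t)
        (by rwa [hN.real_eq_one hr])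
      rw [hN.map_mul, h2, hN.real_eq_one hr, mul_one, hN.map_zpow] at hj
      exact zpow_right_injective₀ (hN.pos _ h0) hϖ.ne hj
    subst hk
    have hr' := even_pos j r t hr ht ha'
    obtain ⟨i, s, u, hs, hu, rfl⟩ := hN.exists_eq_zpow_mul_add h1 h0 hgen hb
    have hcase : 0 < s ∨ (s < 0 ∧ Odd i) := by
      rcases lt_or_gt_of_ne hs with h | h
      · refine Or.inr ⟨h, ?_⟩
        rw [← Int.not_even_iff_odd]
        rintro ⟨i', rfl⟩
        exact absurd (even_pos i' s u hs hu hb') (not_lt.2 h.le)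
      · exact Or.inl h
    rcases hcase with h | ⟨h, hi⟩
    · obtain ⟨pos, hp, hpos⟩ := hN.exists_isPosCone h1 h0 hϖ hgen
      exact ⟨pos, hp, hpos _ _ _ hr' ht, hpos _ _ _ h hu⟩
    · obtain ⟨pos, hp, hpos⟩ := hN.exists_isPosCone h1 (neg_ne_zero.2 h0)
        (by rwa [hN.map_neg]) hgen'
      refine ⟨pos, hp, ?_, ?_⟩
      · have := hpos (j + j) r t hr' ht
        rwa [(Even.neg_zpow ⟨j, rfl⟩ ϖ : (-ϖ) ^ (j + j) = _)] at this
      · have := hpos i (-s) (-u) (by linarith) (by rwa [hN.map_neg])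
        rw [hi.neg_zpow] at this
        simp only [_root_.map_neg] at this
        convert! this using 1
        ring
  by_cases hθe : ∃ j : ℤ, N θ = N ϖ ^ (j + j)
  · exact Or.inl (key θ w hθ0 hw0 hθ hw hθe)
  by_cases hwe : ∃ j : ℤ, N w = N ϖ ^ (j + j)
  · obtain ⟨pos, hp, h2, h3⟩ := key w θ hw0 hθ0 hw hθ hwe
    exact Or.inl ⟨pos, hp, h3, h2⟩
  -- The value of x^(2n) is even. So equal norms would give θ even value, and a smaller norm of θ
  -- would give w the norm of x^(2n), again of even value.
  right
  by_contra! hle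
  have hX0 : algebraMap ℝ⟦X⟧ L X ≠ 0 := by
    intro h
    have := hN.X_pos
    rw [h, hN.map_zero] at this
    exact lt_irrefl _ this
  obtain ⟨k, hk⟩ := hgen _ hX0
  have hXe : N (algebraMap ℝ⟦X⟧ L X) ^ (2 * n) = N ϖ ^ (k * n + k * n) := by
    rw [hk, ← zpow_natCast, ← zpow_mul]
    congr 1
    push_cast
    ring
  rcases hle.eq_or_lt with h | h
  · exact hθe ⟨_, h.trans hXe⟩
  · refine hwe ⟨k * n, ?_⟩
    rw [hwdef, sub_eq_add_neg, hN.add_eq_left (by rwa [hN.map_neg, hN.map_pow]), hN.map_pow, hXe]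

end IsAdicNorm

end

/-! ### Minimal polynomials as norms of the form a² + X b² or a² + b². -/

section

/-- Even and odd parts are written in -X², because at ρ this becomes -ρ² = θ. -/
theorem Polynomial.exists_even_odd {R : Type*} [CommRing R] (g : Polynomial R) :
    ∃ a b : Polynomial R, g = a.comp (-X ^ 2) + X * b.comp (-X ^ 2) := by
  have hX : ∀ g : Polynomial R, (∃ a b : Polynomial R, g = a.comp (-X ^ 2) + X * b.comp (-X ^ 2)) →
      ∃ a b : Polynomial R, g * X = a.comp (-X ^ 2) + X * b.comp (-X ^ 2) := by
    rintro _ ⟨a, b, rfl⟩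
    refine ⟨-(X * b), a, ?_⟩
    simp only [neg_comp, mul_comp, X_comp]
    ring
  induction g using Polynomial.induction_on with
  | C a => exact ⟨C a, 0, by simp⟩
  | add p q hp hq =>
    obtain ⟨a, b, rfl⟩ := hp
    obtain ⟨c, d, rfl⟩ := hq
    exact ⟨a + c, b + d, by simp only [add_comp]; ring⟩
  | monomial n a ih =>
    rw [pow_succ, ← mul_assoc]
    exact hX _ ih

section

variable {R K L : Type*} [CommRing R] [IsDomain R] [IsIntegrallyClosed R] [Field K] [Algebra R K]
  [IsFractionRing R K] [Field L] [Algebra K L] [Algebra R L] [IsScalarTower R K L]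
  [FiniteDimensional K L]

open Polynomial IntermediateField

include K in
/-- If `-θ = ρ ^ 2`, then the minimal polynomial of `θ` has the form `±(a ^ 2 + X * b ^ 2)`. -/
theorem exists_aeval_sq_add_X_mul_sq_eq_zero {ρ : L} (hρ : IsIntegral R ρ) (htop : K⟮ρ⟯ = ⊤) :
    ∃ a b : R[X], aeval (-ρ ^ 2) (a ^ 2 + X * b ^ 2) = 0 ∧
      (a ^ 2 + X * b ^ 2).natDegree = Module.finrank K L ∧
      ((a ^ 2 + X * b ^ 2).leadingCoeff = 1 ∨ (a ^ 2 + X * b ^ 2).leadingCoeff = -1) := by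
  have hm := minpoly.monic hρ
  have hd : (minpoly R ρ).natDegree = Module.finrank K L := by
    rw [← (Field.primitive_element_iff_minpoly_natDegree_eq K ρ).1 htop,
      minpoly.isIntegrallyClosed_eq_field_fractions' K hρ, hm.natDegree_map]
  obtain ⟨a, b, hab⟩ := (minpoly R ρ).exists_even_odd
  have h2 : (-X ^ 2 : R[X]).natDegree = 2 := by simp
  have hl2 : (-X ^ 2 : R[X]).leadingCoeff = -1 := by simp
  have hl1 : (-X : R[X]).leadingCoeff = -1 := by simp
  -- With μ the minimal polynomial of ρ, μ(T) μ(-T) = a(-T²)² - T² b(-T²)², which is a² + X b² at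
  -- -T².
  have hcomp : (a ^ 2 + X * b ^ 2).comp (-X ^ 2) = minpoly R ρ * (minpoly R ρ).comp (-X) := by
    conv_rhs => rw [hab]
    simp only [add_comp, mul_comp, pow_comp, X_comp, neg_comp, comp_assoc, neg_sq]
    ring
  have hnd : ((minpoly R ρ).comp (-X)).natDegree = (minpoly R ρ).natDegree := by
    rw [natDegree_comp]; simp
  have hne : (minpoly R ρ).comp (-X) ≠ 0 := by
    intro h
    have := congrArg (Polynomial.comp · (-X)) h
    simp [comp_assoc, hm.ne_zero] at this
  refine ⟨a, b, ?_, ?_, ?_⟩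
  · have := congrArg (aeval ρ) hcomp
    rw [map_mul, minpoly.aeval, zero_mul, aeval_comp] at this
    simpa using this
  · have := congrArg natDegree hcomp
    rw [natDegree_comp, h2, natDegree_mul hm.ne_zero hne, hnd] at this
    omega
  · have := congrArg leadingCoeff hcomp
    rw [leadingCoeff_comp (by rw [h2]; norm_num), leadingCoeff_mul, hm.leadingCoeff, one_mul,
      leadingCoeff_comp (by simp), hm.leadingCoeff, one_mul, hl2, hl1] at this
    rcases neg_one_pow_eq_or R (a ^ 2 + X * b ^ 2).natDegree with h | h <;>
    rcases neg_one_pow_eq_or R (minpoly R ρ).natDegree with h' | h' <;>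
    rw [h, h'] at this
    · exact Or.inl (by linear_combination this)
    · exact Or.inr (by linear_combination this)
    · exact Or.inr (by linear_combination -this)
    · exact Or.inl (by linear_combination -this)

-- Write z = v + uι. The conjugate v - uι is integral too, hence so are 2v and 2u; since 2 is a unit
-- and R is integrally closed, u and v lie in R.
omit [IsDomain R] in
include K in
theorem exists_eq_add_mul_of_isIntegral (h2 : IsUnit (2 : R)) {ι : L} (hι : ι * ι = -1)
    (hιK : minpoly K ι = X ^ 2 + 1) {z : L} (hz : z ∈ K⟮ι⟯) (hzi : IsIntegral R z) :
    ∃ α β : R, z = algebraMap R L α + algebraMap R L β * ι := by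
  have hιi : IsIntegral K ι := Algebra.IsIntegral.isIntegral ι
  have hιR : IsIntegral R ι := ⟨X ^ 2 + 1, by monicity!, by simp [pow_two, hι]⟩
  have hm : (X ^ 2 + 1 : K[X]).Monic := by monicity!
  obtain ⟨f, hf⟩ : ∃ f : K[X], aeval ι f = z := by
    rw [← IntermediateField.mem_toSubalgebra,
      IntermediateField.adjoin_simple_toSubalgebra_of_isAlgebraic hιi.isAlgebraic,
      Algebra.adjoin_singleton_eq_range_aeval] at hz
    exact hz
  have hroot : ∀ s : L, s * s = -1 → aeval s f = aeval s (f %ₘ (X ^ 2 + 1)) := by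
    intro s hs
    conv_lhs => rw [← modByMonic_add_div f (X ^ 2 + 1)]
    rw [map_add, map_mul]
    simp [pow_two, hs]
  have hdeg : (f %ₘ (X ^ 2 + 1)).natDegree ≤ 1 := by
    have := natDegree_modByMonic_lt f hm (by
      intro h
      have := congrArg natDegree h
      rw [show (X ^ 2 + 1 : K[X]).natDegree = 2 by compute_degree!] at this
      simp at this)
    rw [show (X ^ 2 + 1 : K[X]).natDegree = 2 by compute_degree!] at this
    omega
  obtain ⟨u, v, huv⟩ := exists_eq_X_add_C_of_natDegree_le_one hdeg
  have hz1 : z = algebraMap K L u * ι + algebraMap K L v := by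
    rw [← hf, hroot ι hι, huv]; simp
  have hconj : IsIntegral R (aeval (-ι) f) := by
    obtain ⟨q, hq, hq0⟩ := hzi
    refine ⟨q, hq, ?_⟩
    have h3 : minpoly K ι ∣ (q.map (algebraMap R K)).comp f := by
      apply minpoly.dvd
      rw [aeval_comp, hf, aeval_map_algebraMap]
      exact hq0
    obtain ⟨c, hc⟩ := h3
    have h4 := congrArg (aeval (-ι)) hc
    rw [aeval_comp, aeval_map_algebraMap, map_mul, hιK] at h4
    rw [← aeval_def, h4]
    simp [pow_two, hι]
  rw [hroot (-ι) (by simpa using hι), huv] at hconj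
  have hv : IsIntegral R (algebraMap R K ↑h2.unit⁻¹ * (2 * v)) := by
    refine IsIntegral.mul isIntegral_algebraMap ?_
    rw [← isIntegral_algebraMap_iff (algebraMap K L).injective]
    convert! hzi.add hconj using 1
    rw [hz1]
    simp [map_ofNat]
    ring
  have hu : IsIntegral R (algebraMap R K ↑h2.unit⁻¹ * (2 * u)) := by
    refine IsIntegral.mul isIntegral_algebraMap ?_
    rw [← isIntegral_algebraMap_iff (algebraMap K L).injective]
    convert! ((hzi.sub hconj).mul hιR).neg using 1
    rw [hz1]
    simp [map_ofNat]
    linear_combination (2 * algebraMap K L u) * hι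
  have h2' : ∀ t : K, algebraMap R K ↑h2.unit⁻¹ * (2 * t) = t := by
    intro t
    rw [← mul_assoc, ← map_ofNat (algebraMap R K) 2, ← map_mul]
    simp
  rw [h2'] at hu hv
  obtain ⟨β, rfl⟩ := IsIntegrallyClosed.isIntegral_iff.1 hu
  obtain ⟨α, rfl⟩ := IsIntegrallyClosed.isIntegral_iff.1 hv
  refine ⟨α, β, ?_⟩
  rw [hz1, ← IsScalarTower.algebraMap_apply, ← IsScalarTower.algebraMap_apply, add_comm]

include K in
/-- If `-1` is a square in `L = K(θ)` but not in `K`, then the minimal polynomial of `θ` has the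
form `a ^ 2 + b ^ 2`. -/
theorem exists_aeval_sq_add_sq_eq_zero (h2 : IsUnit (2 : R)) {ι θ : L} (hι : ι * ι = -1)
    (hιK : minpoly K ι = X ^ 2 + 1) (hθ : IsIntegral R θ) (htop : K⟮θ⟯ = ⊤) :
    ∃ a b : R[X], aeval θ (a ^ 2 + b ^ 2) = 0 ∧
      (a ^ 2 + b ^ 2).natDegree = Module.finrank K L ∧ (a ^ 2 + b ^ 2).Monic := by
  set E := K⟮ι⟯ with hE
  have : IsScalarTower R E L := IsScalarTower.of_algebraMap_eq fun r => by
    rw [IsScalarTower.algebraMap_apply R K L, IsScalarTower.algebraMap_apply R K E]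
    rfl
  set g := minpoly E θ with hg
  have hgm : g.Monic := minpoly.monic (Algebra.IsIntegral.isIntegral θ)
  have hlift := integralClosure.mem_lifts_of_monic_of_dvd_map (R := R) E (minpoly.monic hθ) hgm
    (minpoly.dvd E θ (by rw [aeval_map_algebraMap, minpoly.aeval]))
  have hcoeff : ∀ i, ∃ α β : R, (g.coeff i : L) = algebraMap R L α + algebraMap R L β * ι := by
    intro i
    obtain ⟨c, hc⟩ := (lifts_iff_coeff_lifts g).1 hlift i
    refine exists_eq_add_mul_of_isIntegral (K := K) h2 hι hιK (g.coeff i).2 ?_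
    rw [← hc]
    exact IsIntegral.algebraMap (B := L) (A := E) c.2
  -- The minimal polynomial of θ over K(ι) is thus a + ιb with a, b over R. Its norm (a + ιb)(a -
  -- ιb) = a² + b² has twice its degree, which is [L : K].
  choose α β hαβ using hcoeff
  set d := g.natDegree with hd
  set a : R[X] := X ^ d + ∑ i ∈ Finset.range d, C (α i) * X ^ i with ha
  set b : R[X] := ∑ i ∈ Finset.range d, C (β i) * X ^ i with hb
  have hdeg : ∀ γ : ℕ → R, (∑ i ∈ Finset.range d, C (γ i) * X ^ i).degree < (d : WithBot ℕ) := by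
    intro γ
    rw [degree_lt_iff_coeff_zero]
    intro m hm
    rw [finsetSum_coeff]
    refine Finset.sum_eq_zero fun i hi => ?_
    rw [coeff_C_mul_X_pow, if_neg]
    have := Finset.mem_range.1 hi
    omega
  have ham : a.Monic := monic_X_pow_add (hdeg α)
  have hadeg : a.degree = d := by
    rw [ha, degree_add_eq_left_of_degree_lt] <;> rw [degree_X_pow]
    exact hdeg α
  have hand : a.natDegree = d := natDegree_eq_of_degree_eq_some hadeg
  have hlt : (b ^ 2).degree < (a ^ 2).degree := by
    rw [degree_pow, degree_pow, hadeg]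
    by_cases hb0 : b = 0
    · rw [hb0, degree_zero]
      simp
      exact WithBot.bot_lt_coe _
    · have h3 := hdeg β
      rw [← hb, degree_eq_natDegree hb0] at h3
      rw [degree_eq_natDegree hb0]
      simp only [nsmul_eq_mul]
      norm_cast at h3 ⊢
      omega
  have heval : aeval θ a + aeval θ b * ι = 0 := by
    have h3 : aeval θ g = 0 := minpoly.aeval E θ
    rw [hgm.as_sum, ← hd] at h3
    simp only [map_add, map_pow, aeval_X, map_sum, map_mul, aeval_C] at h3
    rw [← h3, ha, hb]
    simp only [map_add, map_pow, aeval_X, map_sum, map_mul, aeval_C, Finset.sum_mul]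
    rw [add_assoc, ← Finset.sum_add_distrib]
    congr 1
    refine Finset.sum_congr rfl fun i _ => ?_
    rw [show algebraMap E L (g.coeff i) = (g.coeff i : L) from rfl, hαβ i]
    ring
  have hfin : Module.finrank K L = 2 * d := by
    have h3 : Module.finrank K E = 2 := by
      rw [hE, IntermediateField.adjoin.finrank (Algebra.IsIntegral.isIntegral ι), hιK]
      compute_degree!
    have h4 : E⟮θ⟯ = ⊤ := by
      rw [eq_top_iff]
      intro z _
      have hz : z ∈ K⟮θ⟯ := htop ▸ IntermediateField.mem_top
      have hle : K⟮θ⟯ ≤ E⟮θ⟯.restrictScalars K := by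
        rw [IntermediateField.adjoin_simple_le_iff]
        exact IntermediateField.mem_adjoin_simple_self E θ
      exact hle hz
    rw [← Module.finrank_mul_finrank K E L, h3,
      ← (Field.primitive_element_iff_minpoly_natDegree_eq E θ).1 h4]
  refine ⟨a, b, ?_, ?_, ?_⟩
  · have h3 : aeval θ (a ^ 2 + b ^ 2) =
        (aeval θ a + aeval θ b * ι) * (aeval θ a - aeval θ b * ι) := by
      simp only [map_add, map_pow]
      linear_combination ((aeval θ b) ^ 2) * hι
    rw [h3, heval, zero_mul]
  · rw [natDegree_eq_of_degree_eq (degree_add_eq_left_of_degree_lt hlt), ham.natDegree_pow, hand,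
      hfin]
  · exact (ham.pow 2).add_of_left hlt

end

end

/-! ### The trichotomy for irreducible distinguished polynomials. -/

section

open LaurentSeries PowerSeries IntermediateField

/-- The preordering of `ℝ⟦x⟧⟦y⟧` generated by `y` and `x ^ m - y`. -/
noncomputable def stripPreordering (m : ℕ) : Subsemiring ℝ⟦X⟧⟦X⟧ :=
  generatedPreordering {X, C X ^ m - X}

theorem sq_mem_stripPreordering (m : ℕ) (a : ℝ⟦X⟧⟦X⟧) : a ^ 2 ∈ stripPreordering m :=
  Subsemiring.subset_closure (Or.inl ⟨a, pow_two a⟩)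

theorem X_mem_stripPreordering (m : ℕ) : X ∈ stripPreordering m :=
  Subsemiring.subset_closure (Or.inr (Or.inl rfl))

theorem sub_mem_stripPreordering (m : ℕ) : C X ^ m - X ∈ stripPreordering m :=
  Subsemiring.subset_closure (Or.inr (Or.inr rfl))

/-- On the strip `0 < y < x ^ m`, the power series `g` is `x ^ e` times a unit. -/
def IsMonomialOnStrip (m e : ℕ) (g : ℝ⟦X⟧⟦X⟧) : Prop :=
  (∃ u, IsUnit u ∧ constantCoeff g = X ^ e * u) ∧
    ∀ i, 1 ≤ i → X ^ (e + 1) ∣ X ^ (m * i) * coeff i g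

theorem LaurentSeries.minpoly_of_mul_self_eq_neg_one {L : Type*} [Field L] [Algebra ℝ⸨X⸩ L] {ι : L}
    (hι : ι * ι = -1) : minpoly ℝ⸨X⸩ ι = Polynomial.X ^ 2 + 1 := by
  have hm : (Polynomial.X ^ 2 + 1 : Polynomial ℝ⸨X⸩).Monic := by monicity!
  have hd : (Polynomial.X ^ 2 + 1 : Polynomial ℝ⸨X⸩).natDegree = 2 := by compute_degree!
  refine (minpoly.eq_of_irreducible_of_monic ?_ (by simp [pow_two, hι]) hm).symm
  apply Polynomial.irreducible_of_degree_le_three_of_not_isRoot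
  · simp [hd]
  · intro k hk
    have hk' : k ^ 2 + 1 = 0 := by simpa using hk
    have hi : IsIntegral ℝ⟦X⟧ k := ⟨Polynomial.X ^ 2 + 1, by monicity!, by simp [hk']⟩
    obtain ⟨b, rfl⟩ := IsIntegrallyClosed.isIntegral_iff.1 hi
    have hb : b ^ 2 + 1 = 0 := by
      apply IsFractionRing.injective ℝ⟦X⟧ ℝ⸨X⸩
      simpa using hk'
    have := congrArg constantCoeff hb
    simp at this
    nlinarith [sq_nonneg (constantCoeff b)]

theorem eq_or_eq_neg_of_aeval_eq_zero {R S : Type*} [CommRing R] [IsDomain R] [CommRing S]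
    [Algebra R S] {P Q : Polynomial R} {θ : S} (hP : P.Monic)
    (hdvd : ∀ p : Polynomial R, Polynomial.aeval θ p = 0 → P ∣ p)
    (hQ : Polynomial.aeval θ Q = 0) (hdeg : Q.natDegree = P.natDegree)
    (hl : Q.leadingCoeff = 1 ∨ Q.leadingCoeff = -1) : P = Q ∨ -P = Q := by
  obtain ⟨c, rfl⟩ := hdvd Q hQ
  have hc0 : c ≠ 0 := by
    rintro rfl
    simp at hl
  rw [hP.natDegree_mul' hc0] at hdeg
  obtain ⟨r, rfl⟩ := Polynomial.natDegree_eq_zero.1 (by omega : c.natDegree = 0)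
  rw [Polynomial.leadingCoeff_mul, hP.leadingCoeff, one_mul, Polynomial.leadingCoeff_C] at hl
  rcases hl with rfl | rfl
  · left; simp
  · right; simp

/-- With d the degree of P, the constant coefficient has norm N(θ)^d and the i-th at most
N(θ)^(d-i). Since N(x)^m < N(θ), the terms with i ≥ 1 are strictly smaller on the strip, and
strictness yields the extra power of x. -/
theorem isMonomialOnStrip_of_lt {L : Type*} [Field L] [Algebra ℝ⸨X⸩ L] [Algebra ℝ⟦X⟧ L]
    [IsScalarTower ℝ⟦X⟧ ℝ⸨X⸩ L] {N : L → ℝ} (hN : IsAdicNorm N) {P : Polynomial ℝ⟦X⟧}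
    (hPm : P.Monic) {θ : L} (hθ : minpoly ℝ⸨X⸩ θ = P.map (algebraMap _ _)) {m : ℕ}
    (h : N (algebraMap ℝ⟦X⟧ L X) ^ m < N θ) : ∃ e, IsMonomialOnStrip m e (P : ℝ⟦X⟧⟦X⟧) := by
  have hX := hN.X_pos
  have hθ0 : 0 < N θ := lt_of_le_of_lt (by positivity) h
  have hd : (minpoly ℝ⸨X⸩ θ).natDegree = P.natDegree := by rw [hθ, hPm.natDegree_map]
  have hc0 := hN.coeff_zero θ
  rw [hd, hθ, Polynomial.coeff_map, ← IsScalarTower.algebraMap_apply] at hc0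
  have hne : P.coeff 0 ≠ 0 := by
    intro h0
    rw [h0, map_zero, hN.map_zero] at hc0
    exact (pow_pos hθ0 _).ne hc0
  obtain ⟨e, u, hu⟩ := IsDiscreteValuationRing.eq_unit_mul_pow_irreducible hne
    PowerSeries.X_irreducible
  have hNe : N θ ^ P.natDegree = N (algebraMap ℝ⟦X⟧ L X) ^ e := by
    rw [← hc0, hu, _root_.map_mul, hN.map_mul, hN.isUnit_eq_one u.isUnit, one_mul, _root_.map_pow,
      hN.map_pow]
  refine ⟨e, ⟨u, u.isUnit, ?_⟩, fun i hi => ?_⟩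
  · rw [← coeff_zero_eq_constantCoeff_apply, Polynomial.coeff_coe, hu, mul_comm]
  · rw [Polynomial.coeff_coe]
    rcases le_or_gt i P.natDegree with hle | hlt
    · apply hN.X_pow_dvd
      have h1 := hN.coeff_le θ i (by omega)
      rw [hd, hθ, Polynomial.coeff_map, ← IsScalarTower.algebraMap_apply] at h1
      rw [_root_.map_mul, hN.map_mul, _root_.map_pow, hN.map_pow, ← hNe, pow_mul]
      calc (N (algebraMap ℝ⟦X⟧ L X) ^ m) ^ i * N (algebraMap ℝ⟦X⟧ L (P.coeff i))
          ≤ (N (algebraMap ℝ⟦X⟧ L X) ^ m) ^ i * N θ ^ (P.natDegree - i) := by gcongr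
        _ < N θ ^ i * N θ ^ (P.natDegree - i) := by
          gcongr
        _ = N θ ^ P.natDegree := by rw [← pow_add]; congr 1; omega
    · simp [Polynomial.coeff_eq_zero_of_natDegree_lt hlt]

section

variable {L : Type} [Field L] [Algebra ℝ⸨X⸩ L] [Algebra ℝ⟦X⟧ L] [IsScalarTower ℝ⟦X⟧ ℝ⸨X⸩ L]
  [FiniteDimensional ℝ⸨X⸩ L]

theorem strip_trichotomy_of_minpoly {P : Polynomial ℝ⟦X⟧}
    (hd : P.IsDistinguishedAt (IsLocalRing.maximalIdeal ℝ⟦X⟧)) {θ : L}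
    (hmin : minpoly ℝ⸨X⸩ θ = P.map (algebraMap ℝ⟦X⟧ ℝ⸨X⸩)) (htop : ℝ⸨X⸩⟮θ⟯ = ⊤) (n : ℕ) :
    ((P : ℝ⟦X⟧⟦X⟧) ∈ stripPreordering (2 * n) ∨ -(P : ℝ⟦X⟧⟦X⟧) ∈ stripPreordering (2 * n)) ∨
    (∃ e, IsMonomialOnStrip (2 * n) e (P : ℝ⟦X⟧⟦X⟧)) ∨
    ∃ (φ : ℝ⟦X⟧⟦X⟧ →+* L) (pos : L → Prop), IsPosCone pos ∧
      pos (φ X) ∧ pos (φ (C X ^ (2 * n) - X)) ∧ φ P = 0 ∧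
      (∀ p : Polynomial ℝ⟦X⟧, φ p = 0 → P ∣ p) ∧ ∀ a, φ a = 0 → (P : ℝ⟦X⟧⟦X⟧) ∣ a := by
  have hm := hd.monic
  have hfin : Module.finrank ℝ⸨X⸩ L = P.natDegree := by
    rw [← (Field.primitive_element_iff_minpoly_natDegree_eq ℝ⸨X⸩ θ).1 htop, hmin,
      hm.natDegree_map]
  have hPθ : Polynomial.aeval θ P = 0 := by
    have := minpoly.aeval ℝ⸨X⸩ θ
    rwa [hmin, Polynomial.aeval_map_algebraMap] at this
  have hθi : IsIntegral ℝ⟦X⟧ θ := ⟨P, hm, hPθ⟩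
  have hdvd : ∀ p : Polynomial ℝ⟦X⟧, Polynomial.aeval θ p = 0 → P ∣ p := by
    intro p hp
    rw [← Polynomial.map_dvd_map _ (IsFractionRing.injective ℝ⟦X⟧ ℝ⸨X⸩) hm, ← hmin]
    exact minpoly.dvd _ _ (by rwa [Polynomial.aeval_map_algebraMap])
  obtain ⟨φ, hφ, hker⟩ := hd.exists_ringHom hPθ
  have hφX : φ X = θ := by simpa using hφ Polynomial.X
  have hφw : φ (C X ^ (2 * n) - X) = algebraMap ℝ⟦X⟧ L X ^ (2 * n) - θ := by
    have := hφ (Polynomial.C X)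
    rw [Polynomial.coe_C, Polynomial.aeval_C] at this
    rw [map_sub, hφX, map_pow, this]
  have coe_mem : ∀ Q : Polynomial ℝ⟦X⟧, (Q : ℝ⟦X⟧⟦X⟧) ∈ stripPreordering (2 * n) →
      (P = Q ∨ -P = Q) →
      ((P : ℝ⟦X⟧⟦X⟧) ∈ stripPreordering (2 * n) ∨ -(P : ℝ⟦X⟧⟦X⟧) ∈ stripPreordering (2 * n)) := by
    rintro Q hQ (rfl | rfl)
    · exact Or.inl hQ
    · exact Or.inr (by simpa using hQ)
  by_cases h1 : IsSquare (-1 : L)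
  · left
    obtain ⟨ι, hι⟩ := h1
    obtain ⟨a, b, h2, h3, h4⟩ := exists_aeval_sq_add_sq_eq_zero (K := ℝ⸨X⸩)
      (PowerSeries.isUnit_iff_constantCoeff.2 (by
        rw [map_ofNat]; exact IsUnit.mk0 (2 : ℝ) two_ne_zero)) hι.symm
      (LaurentSeries.minpoly_of_mul_self_eq_neg_one hι.symm) hθi htop
    refine coe_mem _ ?_ (eq_or_eq_neg_of_aeval_eq_zero hm hdvd h2 (h3.trans hfin) (Or.inl h4))
    push_cast
    exact add_mem (sq_mem_stripPreordering _ _) (sq_mem_stripPreordering _ _)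
  have top_of : ∀ ρ : L, θ ∈ ℝ⸨X⸩⟮ρ⟯ → ℝ⸨X⸩⟮ρ⟯ = ⊤ := by
    intro ρ hρ
    rw [eq_top_iff, ← htop, IntermediateField.adjoin_simple_le_iff]
    exact hρ
  by_cases h2 : IsSquare (-θ)
  · left
    obtain ⟨ρ, hρ⟩ := h2
    have hθρ : θ = -ρ ^ 2 := by rw [pow_two, ← hρ, neg_neg]
    have hρi : IsIntegral ℝ⟦X⟧ ρ := by
      apply IsIntegral.of_pow (n := 2) two_pos
      rw [pow_two, ← hρ]
      exact hθi.neg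
    obtain ⟨a, b, h2, h3, h4⟩ := exists_aeval_sq_add_X_mul_sq_eq_zero (K := ℝ⸨X⸩) hρi
      (top_of ρ (by
        rw [hθρ]
        exact neg_mem (pow_mem (IntermediateField.mem_adjoin_simple_self _ ρ) 2)))
    rw [← hθρ] at h2
    refine coe_mem _ ?_ (eq_or_eq_neg_of_aeval_eq_zero hm hdvd h2 (h3.trans hfin) h4)
    push_cast
    exact add_mem (sq_mem_stripPreordering _ _)
      (mul_mem (X_mem_stripPreordering _) (sq_mem_stripPreordering _ _))
  by_cases h3 : IsSquare (-(algebraMap ℝ⟦X⟧ L X ^ (2 * n) - θ))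
  · left
    obtain ⟨ρ, hρ⟩ := h3
    have hθρ : algebraMap ℝ⟦X⟧ L X ^ (2 * n) - θ = -ρ ^ 2 := by rw [pow_two, ← hρ, neg_neg]
    have hXi : IsIntegral ℝ⟦X⟧ (algebraMap ℝ⟦X⟧ L X ^ (2 * n)) := isIntegral_algebraMap.pow _
    have hρi : IsIntegral ℝ⟦X⟧ ρ := by
      apply IsIntegral.of_pow (n := 2) two_pos
      rw [pow_two, ← hρ]
      exact (hXi.sub hθi).neg
    obtain ⟨a, b, h2, h3, h4⟩ := exists_aeval_sq_add_X_mul_sq_eq_zero (K := ℝ⸨X⸩) hρi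
      (top_of ρ (by
        have : θ = algebraMap ℝ⟦X⟧ L X ^ (2 * n) + ρ ^ 2 := by linear_combination -hθρ
        rw [this, IsScalarTower.algebraMap_apply ℝ⟦X⟧ ℝ⸨X⸩ L]
        exact add_mem (pow_mem (IntermediateField.algebraMap_mem _ _) _)
          (pow_mem (IntermediateField.mem_adjoin_simple_self _ ρ) 2)))
    -- The certificate is found for x^(2n) - θ = -ρ² in place of θ; composing with w returns it to
    -- the variable y.
    set w : Polynomial ℝ⟦X⟧ := Polynomial.C X ^ (2 * n) - Polynomial.X with hw
    have hwd : w.natDegree = 1 := by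
      rw [hw, ← Polynomial.C_pow]
      compute_degree!
    have hwl : w.leadingCoeff = -1 := by
      rw [Polynomial.leadingCoeff, hwd, hw, ← Polynomial.C_pow]
      rw [Polynomial.coeff_sub, Polynomial.coeff_C, if_neg one_ne_zero, Polynomial.coeff_X_one,
        zero_sub]
    have hwθ : Polynomial.aeval θ w = -ρ ^ 2 := by
      rw [← hθρ, hw]
      simp
    refine coe_mem ((a ^ 2 + Polynomial.X * b ^ 2).comp w) ?_
      (eq_or_eq_neg_of_aeval_eq_zero hm hdvd ?_ ?_ ?_)
    · simp only [Polynomial.add_comp, Polynomial.mul_comp, Polynomial.pow_comp, Polynomial.X_comp]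
      push_cast
      refine add_mem (sq_mem_stripPreordering _ _) (mul_mem ?_ (sq_mem_stripPreordering _ _))
      rw [hw]
      push_cast
      exact sub_mem_stripPreordering _
    · rw [Polynomial.aeval_comp, hwθ, h2]
    · rw [Polynomial.natDegree_comp, hwd, mul_one, h3, hfin]
    · rw [Polynomial.leadingCoeff_comp (by omega), hwl]
      rcases h4 with h4 | h4 <;>
      rcases neg_one_pow_eq_or ℝ⟦X⟧ (a ^ 2 + Polynomial.X * b ^ 2).natDegree with h | h <;>
      rw [h4, h] <;> simp
  have hθ0 : θ ≠ 0 := fun h => h2 (by rw [h, neg_zero]; exact IsSquare.zero)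
  have hw0 : algebraMap ℝ⟦X⟧ L X ^ (2 * n) - θ ≠ 0 :=
    fun h => h3 (by rw [h, neg_zero]; exact IsSquare.zero)
  obtain ⟨N, hN⟩ := exists_isAdicNorm L
  right
  rcases hN.exists_isPosCone_or_lt h1 hθ0 hw0 h2 h3 with ⟨pos, hp, hp1, hp2⟩ | hlt
  · right
    refine ⟨φ, pos, hp, ?_, ?_, ?_, ?_, hker hdvd⟩
    · rw [← hφX] at hp1
      exact hp1
    · rw [← hφw] at hp2
      exact hp2
    · exact (hφ P).trans hPθ
    · exact fun p hp => hdvd p ((hφ p).symm.trans hp)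
  · left
    exact isMonomialOnStrip_of_lt hN hm hmin hlt

end

/-- An irreducible distinguished polynomial has, up to sign, an obvious certificate of positivity on
the strip, or it is equivalent to a power of `x` there, or it has a zero in the interior. -/
theorem strip_trichotomy_of_irreducible {P : Polynomial ℝ⟦X⟧} (hP : Irreducible P)
    (hd : P.IsDistinguishedAt (IsLocalRing.maximalIdeal ℝ⟦X⟧)) (n : ℕ) :
    ((P : ℝ⟦X⟧⟦X⟧) ∈ stripPreordering (2 * n) ∨ -(P : ℝ⟦X⟧⟦X⟧) ∈ stripPreordering (2 * n)) ∨
    (∃ e, IsMonomialOnStrip (2 * n) e (P : ℝ⟦X⟧⟦X⟧)) ∨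
    ∃ (L : Type) (_ : Field L) (φ : ℝ⟦X⟧⟦X⟧ →+* L) (pos : L → Prop), IsPosCone pos ∧
      pos (φ X) ∧ pos (φ (C X ^ (2 * n) - X)) ∧ φ P = 0 ∧
      (∀ p : Polynomial ℝ⟦X⟧, φ p = 0 → P ∣ p) ∧ ∀ a, φ a = 0 → (P : ℝ⟦X⟧⟦X⟧) ∣ a := by
  have hFm : (P.map (algebraMap ℝ⟦X⟧ ℝ⸨X⸩)).Monic := hd.monic.map _
  have : Fact (Irreducible (P.map (algebraMap ℝ⟦X⟧ ℝ⸨X⸩))) :=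
    ⟨hd.monic.irreducible_iff_irreducible_map_fraction_map.1 hP⟩
  have hfd : FiniteDimensional ℝ⸨X⸩ (AdjoinRoot (P.map (algebraMap ℝ⟦X⟧ ℝ⸨X⸩))) :=
    (AdjoinRoot.powerBasis hFm.ne_zero).finite
  have hmin : minpoly ℝ⸨X⸩ (AdjoinRoot.root (P.map (algebraMap ℝ⟦X⟧ ℝ⸨X⸩))) =
      P.map (algebraMap ℝ⟦X⟧ ℝ⸨X⸩) := by
    rw [AdjoinRoot.minpoly_root hFm.ne_zero, hFm.leadingCoeff]
    simp
  have htop : ℝ⸨X⸩⟮AdjoinRoot.root (P.map (algebraMap ℝ⟦X⟧ ℝ⸨X⸩))⟯ = ⊤ := by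
    rw [Field.primitive_element_iff_minpoly_natDegree_eq, hmin,
      (AdjoinRoot.powerBasis hFm.ne_zero).finrank, AdjoinRoot.powerBasis_dim]
  rcases strip_trichotomy_of_minpoly hd hmin htop n with h | h | ⟨φ, pos, h⟩
  · exact Or.inl h
  · exact Or.inr (Or.inl h)
  · exact Or.inr (Or.inr ⟨_, inferInstance, φ, pos, h⟩)

end

/-! ### Lifting orderings, and estimates on the strip. -/

section

open LaurentSeries PowerSeries

namespace IsPosCone

variable {R : Type*} [CommRing R] {pos : R → Prop} (h : IsPosCone pos)
include h

theorem not_neg {a : R} (ha : pos a) : ¬ pos (-a) := fun hb =>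
  h.zero (by simpa using h.add ha hb)

theorem mul_self {a : R} (ha : a ≠ 0) : pos (a * a) := by
  rcases h.total ha with h1 | h1
  · exact h.mul h1 h1
  · simpa using h.mul h1 h1

theorem one [Nontrivial R] : pos 1 := by
  simpa using h.mul_self one_ne_zero

theorem of_mul {a b : R} (ha : pos a) (hab : pos (a * b)) : pos b := by
  have hb : b ≠ 0 := by
    rintro rfl
    exact h.zero (by simpa using hab)
  refine (h.total hb).resolve_right fun hb' => h.not_neg hab ?_
  simpa using h.mul ha hb'

theorem eq_zero_or_pos_of_mem [IsDomain R] {D : Type*} [CommRing D] (φ : D →+* R) {S : Set D}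
    (hS : ∀ s ∈ S, pos (φ s)) {a : D} (ha : a ∈ generatedPreordering S) :
    φ a = 0 ∨ pos (φ a) := by
  induction ha using Subsemiring.closure_induction with
  | mem a ha =>
    rcases ha with ⟨b, rfl⟩ | ha
    · rw [map_mul]
      by_cases hb : φ b = 0
      · simp [hb]
      · exact Or.inr (h.mul_self hb)
    · exact Or.inr (hS a ha)
  | zero => exact Or.inl (map_zero φ)
  | one => exact Or.inr (by simpa using h.one)
  | add a b _ _ ha hb =>
    rw [map_add]
    rcases ha with ha | ha
    · simpa [ha] using hb
    rcases hb with hb | hb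
    · simpa [hb] using Or.inr ha
    exact Or.inr (h.add ha hb)
  | mul a b _ _ ha hb =>
    rw [map_mul]
    rcases ha with ha | ha
    · simp [ha]
    rcases hb with hb | hb
    · simp [hb]
    exact Or.inr (h.mul ha hb)

theorem comap {D : Type*} [CommRing D] (φ : D →+* R) (hφ : Function.Injective φ) :
    IsPosCone fun a => pos (φ a) where
  add ha hb := by simpa using h.add ha hb
  mul ha hb := by simpa using h.mul ha hb
  zero := by simpa using h.zero
  total ha := by simpa using h.total ((map_ne_zero_iff φ hφ).2 ha)

/-- An ordering of the residue ring at a prime element lifts to an ordering for which that element is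
positive and infinitesimal. -/
theorem exists_lift [Nontrivial R] {D : Type*} [CommRing D] [IsDomain D] (φ : D →+* R) {p : D}
    (hp0 : p ≠ 0) (hp : φ p = 0) (hfac : ∀ a : D, a ≠ 0 → ∃ k b, a = p ^ k * b ∧ φ b ≠ 0) :
    ∃ pos' : D → Prop, IsPosCone pos' ∧ pos' p ∧ ∀ b, pos (φ b) → pos' b := by
  have hadd : ∀ (k j : ℕ) (b c : D), k ≤ j → pos (φ b) → pos (φ c) →
      ∃ d, pos (φ d) ∧ p ^ k * b + p ^ j * c = p ^ k * d := by
    intro k j b c hkj hb hc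
    obtain ⟨i, rfl⟩ := Nat.exists_eq_add_of_le hkj
    refine ⟨b + p ^ i * c, ?_, by ring⟩
    rcases Nat.eq_zero_or_pos i with rfl | hi
    · simpa using h.add hb hc
    · simpa [hp, hi.ne'] using hb
  refine ⟨fun a => ∃ k b, a = p ^ k * b ∧ pos (φ b), ⟨?_, ?_, ?_, ?_⟩,
    ⟨1, 1, by simp, by simpa using h.one⟩, fun b hb => ⟨0, b, by simp, hb⟩⟩
  · rintro _ _ ⟨k, b, rfl, hb⟩ ⟨j, c, rfl, hc⟩
    rcases le_total k j with hkj | hkj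
    · obtain ⟨d, hd, he⟩ := hadd k j b c hkj hb hc
      exact ⟨k, d, he, hd⟩
    · obtain ⟨d, hd, he⟩ := hadd j k c b hkj hc hb
      exact ⟨j, d, by rw [add_comm, he], hd⟩
  · rintro _ _ ⟨k, b, rfl, hb⟩ ⟨j, c, rfl, hc⟩
    exact ⟨k + j, b * c, by ring, by simpa using h.mul hb hc⟩
  · rintro ⟨k, b, h0, hb⟩
    rw [zero_eq_mul] at h0
    rw [h0.resolve_left (pow_ne_zero k hp0), map_zero] at hb
    exact h.zero hb
  · intro a ha
    obtain ⟨k, b, rfl, hb⟩ := hfac a ha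
    rcases h.total hb with h1 | h1
    · exact Or.inl ⟨k, b, rfl, h1⟩
    · exact Or.inr ⟨k, -b, by ring, by simpa using h1⟩

end IsPosCone

theorem pow_sub_pow_mem_stripPreordering (m i : ℕ) (hm : Even m) :
    (C X ^ m) ^ i - X ^ i ∈ stripPreordering m := by
  induction i with
  | zero => simp
  | succ i ih =>
    have h1 : (C X ^ m : ℝ⟦X⟧⟦X⟧) ∈ stripPreordering m := by
      obtain ⟨j, rfl⟩ := hm
      rw [← two_mul, mul_comm, pow_mul]
      exact sq_mem_stripPreordering _ _
    have h2 : (C X ^ m : ℝ⟦X⟧⟦X⟧) ^ (i + 1) - X ^ (i + 1) =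
        C X ^ m * ((C X ^ m) ^ i - X ^ i) + (C X ^ m - X) * X ^ i := by ring
    rw [h2]
    exact add_mem (mul_mem h1 ih)
      (mul_mem (sub_mem_stripPreordering m) (pow_mem (X_mem_stripPreordering m) i))

theorem mem_stripPreordering_of_pos (m : ℕ) {u : ℝ⟦X⟧⟦X⟧}
    (hu : 0 < constantCoeff (constantCoeff u)) : u ∈ stripPreordering m :=
  Subsemiring.subset_closure (Or.inl (isSquare_of_pos₂ hu))

/-- `h` is bounded below by `-ε * x ^ (2 * k)` on the strip `0 < y < x ^ (2 * n)`, for all `ε > 0`. -/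
def IsNegligibleOnStrip (n k : ℕ) (h : ℝ⟦X⟧⟦X⟧) : Prop :=
  ∀ ε : ℝ, 0 < ε → C (C ε) * C X ^ (2 * k) + h ∈ stripPreordering (2 * n)

namespace IsNegligibleOnStrip

variable {n k : ℕ}

theorem add {h h' : ℝ⟦X⟧⟦X⟧} (hh : IsNegligibleOnStrip n k h) (hh' : IsNegligibleOnStrip n k h') :
    IsNegligibleOnStrip n k (h + h') := by
  intro ε hε
  have := add_mem (hh (ε / 2) (by positivity)) (hh' (ε / 2) (by positivity))
  convert! this using 1
  have h2 : (C (C ε) : ℝ⟦X⟧⟦X⟧) = C (C (ε / 2)) + C (C (ε / 2)) := by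
    rw [← map_add, ← map_add, add_halves]
  rw [h2]
  ring

theorem zero : IsNegligibleOnStrip n k 0 := by
  intro ε hε
  rw [add_zero, mul_comm 2 k, pow_mul]
  exact mul_mem (mem_stripPreordering_of_pos _ (by simpa using hε)) (sq_mem_stripPreordering _ _)

theorem sum {ι : Type*} (s : Finset ι) (f : ι → ℝ⟦X⟧⟦X⟧)
    (hf : ∀ i ∈ s, IsNegligibleOnStrip n k (f i)) : IsNegligibleOnStrip n k (∑ i ∈ s, f i) := by
  classical
  induction s using Finset.induction_on with
  | empty => simpa using zero
  | insert a s ha ih =>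
    rw [Finset.sum_insert ha]
    exact (hf a (Finset.mem_insert_self a s)).add
      (ih fun i hi => hf i (Finset.mem_insert_of_mem hi))

/-- On the strip y^i ≤ x^(2ni), so the product is bounded below by -M x^(2(j + ni)) for suitable M.
This is absorbed by ε x^(2k) if the exponent is larger, or with M = ε if h vanishes at the origin.
-/
theorem X_pow_mul {i j : ℕ} {h : ℝ⟦X⟧⟦X⟧}
    (hle : k < j + n * i ∨ k = j + n * i ∧ constantCoeff (constantCoeff h) = 0) :
    IsNegligibleOnStrip n k (X ^ i * C X ^ (2 * j) * h) := by
  intro ε hε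
  obtain ⟨M, hM, hM1, hM2⟩ : ∃ M : ℝ, 0 < M ∧ 0 < M + constantCoeff (constantCoeff h) ∧
      C (C ε) * C X ^ (2 * k) - C (C M) * C X ^ (2 * (j + n * i)) ∈ stripPreordering (2 * n) := by
    rcases hle with hlt | ⟨rfl, h0⟩
    · refine ⟨|constantCoeff (constantCoeff h)| + 1, by positivity, ?_, ?_⟩
      · have := neg_abs_le (constantCoeff (constantCoeff h))
        linarith
      · obtain ⟨d, hd⟩ := Nat.exists_eq_add_of_lt hlt
        have : ∀ c : ℝ, (C (C ε) * C X ^ (2 * k) - C (C c) * C X ^ (2 * (j + n * i)) : ℝ⟦X⟧⟦X⟧) =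
            (C X ^ k) ^ 2 * (C (C ε) - C (C c) * C X ^ (2 * (d + 1))) := by
          intro c
          rw [hd]
          ring
        rw [this]
        exact mul_mem (sq_mem_stripPreordering _ _)
          (mem_stripPreordering_of_pos _ (by simpa using hε))
    · refine ⟨ε, hε, by rwa [h0, add_zero], ?_⟩
      rw [sub_self]
      exact zero_mem _
  have hid : C (C ε) * C X ^ (2 * k) + X ^ i * C X ^ (2 * j) * h =
      X ^ i * (C X ^ j) ^ 2 * (C (C M) + h) +
      C (C M) * (C X ^ j) ^ 2 * ((C X ^ (2 * n)) ^ i - X ^ i) +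
      (C (C ε) * C X ^ (2 * k) - C (C M) * C X ^ (2 * (j + n * i))) := by
    ring
  rw [hid]
  have hMT := mem_stripPreordering_of_pos (2 * n) (u := C (C M)) (by simpa using hM)
  refine add_mem (add_mem (mul_mem (mul_mem (pow_mem (X_mem_stripPreordering _) _)
    (sq_mem_stripPreordering _ _)) (mem_stripPreordering_of_pos _ ?_))
    (mul_mem (mul_mem hMT (sq_mem_stripPreordering _ _))
      (pow_sub_pow_mem_stripPreordering _ _ (even_two_mul n)))) hM2
  simpa using hM1

end IsNegligibleOnStrip

theorem PowerSeries.exists_eq_sum_add_X_pow_mul {R : Type*} [CommRing R] (g : R⟦X⟧) (s : ℕ) :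
    ∃ t, g = ∑ i ∈ Finset.range s, C (coeff i g) * X ^ i + X ^ s * t := by
  have : X ^ s ∣ g - ∑ i ∈ Finset.range s, C (coeff i g) * X ^ i := by
    rw [X_pow_dvd_iff]
    intro m hm
    rw [map_sub, map_sum]
    simp [coeff_X_pow, hm]
  obtain ⟨t, ht⟩ := this
  exact ⟨t, by rw [← ht]; ring⟩

namespace IsMonomialOnStrip

theorem mul {m e e' : ℕ} {g g' : ℝ⟦X⟧⟦X⟧} (hg : IsMonomialOnStrip m e g)
    (hg' : IsMonomialOnStrip m e' g') : IsMonomialOnStrip m (e + e') (g * g') := by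
  obtain ⟨⟨u, hu, h1⟩, h2⟩ := hg
  obtain ⟨⟨u', hu', h1'⟩, h2'⟩ := hg'
  have weak : ∀ (e : ℕ) (g : ℝ⟦X⟧⟦X⟧) (u : ℝ⟦X⟧), constantCoeff g = X ^ e * u →
      (∀ i, 1 ≤ i → X ^ (e + 1) ∣ X ^ (m * i) * coeff i g) →
      ∀ i, X ^ e ∣ X ^ (m * i) * coeff i g := by
    intro e g u h1 h2 i
    rcases Nat.eq_zero_or_pos i with rfl | hi
    · simp [h1]
    · exact (pow_dvd_pow X (Nat.le_succ e)).trans (h2 i hi)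
  refine ⟨⟨u * u', hu.mul hu', by rw [_root_.map_mul, h1, h1']; ring⟩, fun i hi => ?_⟩
  rw [coeff_mul, Finset.mul_sum]
  refine Finset.dvd_sum fun p hp => ?_
  rw [Finset.HasAntidiagonal.mem_antidiagonal] at hp
  have h3 : X ^ (m * i) * (coeff p.1 g * coeff p.2 g') =
      (X ^ (m * p.1) * coeff p.1 g) * (X ^ (m * p.2) * coeff p.2 g') := by
    rw [← hp]
    ring
  rw [h3]
  rcases Nat.eq_zero_or_pos p.1 with h0 | h0
  · rw [add_assoc, pow_add]
    exact mul_dvd_mul (weak e g u h1 h2 _) (h2' _ (by omega))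
  · rw [add_right_comm, pow_add]
    exact mul_dvd_mul (h2 _ h0) (weak e' g' u' h1' h2' _)

theorem of_isUnit {m : ℕ} (hm : 1 ≤ m) {g : ℝ⟦X⟧⟦X⟧} (hg : IsUnit g) : IsMonomialOnStrip m 0 g := by
  refine ⟨⟨constantCoeff g, hg.map _, by simp⟩, fun i hi => ?_⟩
  exact Dvd.dvd.mul_right (pow_dvd_pow X (by nlinarith)) _

theorem C_X (m : ℕ) : IsMonomialOnStrip m 1 (C X) := by
  refine ⟨⟨1, isUnit_one, by simp⟩, fun i hi => ?_⟩
  rw [coeff_C, if_neg (by omega), mul_zero]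
  exact dvd_zero _

theorem neg {m e : ℕ} {g : ℝ⟦X⟧⟦X⟧} (hg : IsMonomialOnStrip m e g) : IsMonomialOnStrip m e (-g) := by
  obtain ⟨⟨u, hu, h1⟩, h2⟩ := hg
  refine ⟨⟨-u, hu.neg, by rw [map_neg, h1]; ring⟩, fun i hi => ?_⟩
  rw [map_neg, mul_neg, dvd_neg]
  exact h2 i hi

/-- All terms beyond the constant one in y are negligible against x^(2k). Of the leading constant c,
half stays with the leading term, a quarter absorbs the negligible terms and a quarter remains as δ.
-/
theorem exists_sub_mem {n k : ℕ} (hn : 1 ≤ n) {g : ℝ⟦X⟧⟦X⟧} (hg : IsMonomialOnStrip (2 * n) (2 * k) g)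
    {u : ℝ⟦X⟧} (hu : constantCoeff g = X ^ (2 * k) * u) (hpos : 0 < constantCoeff u) :
    ∃ δ : ℝ, 0 < δ ∧ g - C (C δ) * C X ^ (2 * k) ∈ stripPreordering (2 * n) := by
  set c := constantCoeff u with hc
  refine ⟨c / 4, by positivity, ?_⟩
  -- From y-exponent k + 1 on, n ≥ 1 makes a term negligible whatever its coefficient, so the tail
  -- needs no divisibility.
  obtain ⟨t, ht⟩ := g.exists_eq_sum_add_X_pow_mul (k + 1 + 1)
  rw [Finset.sum_range_succ'] at ht
  have htail : IsNegligibleOnStrip n k (X ^ (k + 1 + 1) * t) := by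
    have := IsNegligibleOnStrip.X_pow_mul (n := n) (k := k) (i := k + 1 + 1) (j := 0) (h := t)
      (Or.inl (by nlinarith))
    simpa using this
  have hsum : IsNegligibleOnStrip n k
      (∑ i ∈ Finset.range (k + 1), C (coeff (i + 1) g) * X ^ (i + 1)) := by
    refine IsNegligibleOnStrip.sum _ _ fun i _ => ?_
    have hdvd := hg.2 (i + 1) (by omega)
    rcases lt_or_ge k (n * (i + 1)) with hlt | hle
    · have := IsNegligibleOnStrip.X_pow_mul (n := n) (k := k) (i := i + 1) (j := 0)
        (h := C (coeff (i + 1) g)) (Or.inl (by omega))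
      convert! this using 1
      ring
    · obtain ⟨j, hj⟩ := Nat.exists_eq_add_of_le hle
      -- Divisibility by x^(2k+1) rather than x^(2k) leaves the coefficient as x^(2j) times a series
      -- vanishing at the origin: the borderline case of `X_pow_mul`.
      have h3 : 2 * k + 1 = 2 * n * (i + 1) + (2 * j + 1) := by rw [hj]; ring
      rw [h3, pow_add _ (2 * n * (i + 1))] at hdvd
      obtain ⟨b, hb⟩ := (mul_dvd_mul_iff_left (pow_ne_zero _ X_ne_zero)).1 hdvd
      have := IsNegligibleOnStrip.X_pow_mul (n := n) (k := k) (i := i + 1) (j := j)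
        (h := C (X * b)) (Or.inr ⟨by omega, by simp⟩)
      convert! this using 1
      rw [hb]
      simp only [_root_.map_mul, map_pow]
      ring
  have hneg := (hsum.add htail) (c / 4) (by positivity)
  have hlead : C X ^ (2 * k) * C (u - C (c / 2)) ∈ stripPreordering (2 * n) := by
    rw [mul_comm 2 k, pow_mul]
    refine mul_mem (sq_mem_stripPreordering _ _) (mem_stripPreordering_of_pos _ ?_)
    simp [← hc]
    linarith
  convert! add_mem hlead hneg using 1
  conv_lhs => rw [ht]
  rw [pow_zero, mul_one, coeff_zero_eq_constantCoeff_apply, hu]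
  have h2 : (C (C (c / 2)) : ℝ⟦X⟧⟦X⟧) = C (C (c / 4)) + C (C (c / 4)) := by
    rw [← map_add, ← map_add]; congr 2; ring
  simp only [_root_.map_mul, map_pow, map_sub, h2]
  ring

end IsMonomialOnStrip

end

/-! ### Factorization on the strip, sign changes, and part (1). -/

section

open LaurentSeries PowerSeries

theorem isPosCone_real : IsPosCone fun r : ℝ => 0 < r where
  add := add_pos
  mul := mul_pos
  zero := lt_irrefl 0
  total ha := by
    rcases lt_or_gt_of_ne ha with h | h
    · exact Or.inr (by linarith)
    · exact Or.inl h

/-- Orderings of `ℝ⟦x⟧⟦y⟧` with `y` positive and infinitely small with respect to `s = ± x`. -/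
theorem exists_isPosCone_strip (n : ℕ) {s : ℝ⟦X⟧} (hs : s = X ∨ s = -X) :
    ∃ pos : ℝ⟦X⟧⟦X⟧ → Prop, IsPosCone pos ∧ pos X ∧ pos (C X ^ (2 * n) - X) ∧
      ∀ (k : ℕ) (u : ℝ⟦X⟧) (g : ℝ⟦X⟧⟦X⟧), 0 < constantCoeff u → constantCoeff g = s ^ k * u →
        pos g := by
  have hs0 : s ≠ 0 := by rcases hs with rfl | rfl <;> simp [X_ne_zero]
  -- Two successive lifts from ℝ: first s is made a positive infinitesimal, then y one relative to
  -- s.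
  obtain ⟨pos, hp, hps, hpu⟩ := isPosCone_real.exists_lift (constantCoeff (R := ℝ)) hs0
    (by rcases hs with rfl | rfl <;> simp) (fun a ha => by
      obtain ⟨k, u, rfl⟩ := IsDiscreteValuationRing.eq_unit_mul_pow_irreducible ha
        PowerSeries.X_irreducible
      have hu : constantCoeff (u : ℝ⟦X⟧) ≠ 0 := (u.isUnit.map constantCoeff).ne_zero
      rcases hs with rfl | rfl
      · exact ⟨k, u, mul_comm _ _, hu⟩
      · refine ⟨k, (-1) ^ k * u, ?_, by simpa using hu⟩
        rw [← mul_assoc, ← mul_pow]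
        simp [mul_comm])
  obtain ⟨pos', hp', hpX, hpc⟩ := hp.exists_lift (constantCoeff (R := ℝ⟦X⟧)) X_ne_zero
    (by simp) (fun a ha => by
      obtain ⟨b, hb, hb'⟩ := (FiniteMultiplicity.of_not_isUnit
        (X_prime (R := ℝ⟦X⟧)).not_isUnit ha).exists_eq_pow_mul_and_not_dvd
      exact ⟨_, b, hb, by rwa [X_dvd_iff] at hb'⟩)
  have hpow : ∀ k, pos (s ^ k) := by
    intro k
    induction k with
    | zero => simpa using hp.one
    | succ k ih => rw [pow_succ]; exact hp.mul ih hps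
  refine ⟨pos', hp', hpX, hpc _ ?_, fun k u g hu hg => hpc _ ?_⟩
  · have : constantCoeff (C X ^ (2 * n) - X : ℝ⟦X⟧⟦X⟧) = s ^ (2 * n) := by
      rcases hs with rfl | rfl <;> simp [pow_mul]
    rw [this]
    exact hpow _
  · rw [hg]
    exact hp.mul (hpow k) (hpu u hu)

/-- The irreducible polynomial `P` vanishes at a point of the interior of the strip. -/
def HasInteriorZero (n : ℕ) (P : Polynomial ℝ⟦X⟧) : Prop :=
  ∃ (L : Type) (_ : Field L) (φ : ℝ⟦X⟧⟦X⟧ →+* L) (pos : L → Prop), IsPosCone pos ∧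
    pos (φ X) ∧ pos (φ (C X ^ (2 * n) - X)) ∧ φ P = 0 ∧
    (∀ p : Polynomial ℝ⟦X⟧, φ p = 0 → P ∣ p) ∧ ∀ a, φ a = 0 → (P : ℝ⟦X⟧⟦X⟧) ∣ a

theorem IsMonomialOnStrip.map_ne_zero {n e : ℕ} (hn : 1 ≤ n) {g : ℝ⟦X⟧⟦X⟧}
    (hg : IsMonomialOnStrip (2 * n) e g) {L : Type*} [Field L] {φ : ℝ⟦X⟧⟦X⟧ →+* L} {pos : L → Prop}
    (hp : IsPosCone pos) (hy : pos (φ X)) (hw : pos (φ (C X ^ (2 * n) - X))) (hx : φ (C X) ≠ 0) :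
    φ g ≠ 0 := by
  have key : ∀ (k : ℕ) (g : ℝ⟦X⟧⟦X⟧) (u : ℝ⟦X⟧), IsMonomialOnStrip (2 * n) (2 * k) g →
      constantCoeff g = X ^ (2 * k) * u → 0 < constantCoeff u → φ g ≠ 0 := by
    intro k g u hg hu hpos h0
    obtain ⟨δ, hδ, hmem⟩ := hg.exists_sub_mem hn hu hpos
    have h1 : pos (φ (C (C δ) * C X ^ (2 * k))) := by
      obtain ⟨r, hr⟩ := isSquare_of_pos₂ (u := C (C δ)) (by simpa using hδ)
      have hr0 : φ (C (C δ)) ≠ 0 :=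
        ((PowerSeries.isUnit_iff_constantCoeff.2 (PowerSeries.isUnit_iff_constantCoeff.2
          (by simpa using hδ.ne')) : IsUnit (C (C δ) : ℝ⟦X⟧⟦X⟧)).map φ).ne_zero
      rw [hr, map_mul] at hr0
      have : φ (C (C δ) * C X ^ (2 * k)) = (φ r * φ (C X) ^ k) * (φ r * φ (C X) ^ k) := by
        rw [hr]
        simp only [map_mul, map_pow]
        ring
      rw [this]
      exact hp.mul_self (mul_ne_zero (left_ne_zero_of_mul hr0) (pow_ne_zero k hx))
    have h2 := hp.eq_zero_or_pos_of_mem φ (by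
      rintro s (rfl | rfl)
      · exact hy
      · exact hw) hmem
    rw [map_sub, h0, zero_sub, neg_eq_zero] at h2
    rcases h2 with h2 | h2
    · rw [h2] at h1
      exact hp.zero h1
    · exact hp.not_neg h1 h2
  have key' : ∀ (k : ℕ) (g : ℝ⟦X⟧⟦X⟧), IsMonomialOnStrip (2 * n) (2 * k) g → φ g ≠ 0 := by
    intro k g hg
    obtain ⟨u, hu, h1⟩ := hg.1
    have hu0 : constantCoeff u ≠ 0 := (hu.map constantCoeff).ne_zero
    rcases lt_or_gt_of_ne hu0 with h | h
    · have := key k (-g) (-u) hg.neg (by rw [map_neg, h1]; ring) (by rw [map_neg]; linarith)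
      rwa [map_neg, neg_ne_zero] at this
    · exact key k g u hg h1 h
  rcases Nat.even_or_odd' e with ⟨k, rfl | rfl⟩
  · exact key' k g hg
  -- An odd exponent is made even by multiplying by x.
  · have := key' (k + 1) (g * C X) (hg.mul (IsMonomialOnStrip.C_X _))
    rw [map_mul] at this
    exact left_ne_zero_of_mul this

/-- Modulo the maximal ideal the product is a power of X, so its monic factors are powers of X as
well. -/
theorem Polynomial.IsDistinguishedAt.of_mul {q r : Polynomial ℝ⟦X⟧} (hq : q.Monic)
    (h : (q * r).IsDistinguishedAt (IsLocalRing.maximalIdeal ℝ⟦X⟧)) :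
    q.IsDistinguishedAt (IsLocalRing.maximalIdeal ℝ⟦X⟧) := by
  have h1 := h.map_eq_X_pow
  rw [Polynomial.map_mul] at h1
  have : IsDomain (ℝ⟦X⟧ ⧸ IsLocalRing.maximalIdeal ℝ⟦X⟧) := Ideal.Quotient.isDomain _
  obtain ⟨j, -, hj⟩ := (dvd_prime_pow Polynomial.prime_X _).1 (Dvd.intro _ h1)
  have h2 := Polynomial.eq_of_monic_of_associated (hq.map _) (Polynomial.monic_X_pow j) hj
  have hd : q.natDegree = j := by
    rw [← hq.natDegree_map (Ideal.Quotient.mk (IsLocalRing.maximalIdeal ℝ⟦X⟧)), h2,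
      Polynomial.natDegree_X_pow]
  refine ⟨⟨fun {i} hi => ?_⟩, hq⟩
  rw [← Ideal.Quotient.eq_zero_iff_mem, ← Polynomial.coeff_map, h2, Polynomial.coeff_X_pow,
    if_neg (by omega)]

theorem Polynomial.IsDistinguishedAt.exists_irreducible_mul {P : Polynomial ℝ⟦X⟧}
    (hP : P.IsDistinguishedAt (IsLocalRing.maximalIdeal ℝ⟦X⟧)) (h0 : P.natDegree ≠ 0) :
    ∃ q r : Polynomial ℝ⟦X⟧, P = q * r ∧ Irreducible q ∧
      q.IsDistinguishedAt (IsLocalRing.maximalIdeal ℝ⟦X⟧) ∧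
      r.IsDistinguishedAt (IsLocalRing.maximalIdeal ℝ⟦X⟧) ∧ r.natDegree < P.natDegree := by
  have hm := hP.monic
  have hnu : ¬ IsUnit P := fun h => h0 (Polynomial.natDegree_eq_zero_of_isUnit h)
  obtain ⟨q, hq, r, rfl⟩ := WfDvdMonoid.exists_irreducible_factor hnu hm.ne_zero
  have hl : q.leadingCoeff * r.leadingCoeff = 1 := by
    rw [← Polynomial.leadingCoeff_mul]
    exact hm
  have hu : IsUnit (Polynomial.C r.leadingCoeff) :=
    (IsUnit.of_mul_eq_one _ ((mul_comm _ _).trans hl)).map Polynomial.C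
  have heq : q * r = (q * Polynomial.C r.leadingCoeff) * (r * Polynomial.C q.leadingCoeff) := by
    have : Polynomial.C q.leadingCoeff * Polynomial.C r.leadingCoeff = 1 := by
      rw [← Polynomial.C_mul, hl, Polynomial.C_1]
    linear_combination (-(q * r)) * this
  have hqm : (q * Polynomial.C r.leadingCoeff).Monic := by
    rw [Polynomial.Monic, Polynomial.leadingCoeff_mul, Polynomial.leadingCoeff_C, hl]
  have hrm : (r * Polynomial.C q.leadingCoeff).Monic := by
    rw [Polynomial.Monic, Polynomial.leadingCoeff_mul, Polynomial.leadingCoeff_C, mul_comm, hl]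
  have hqi : Irreducible (q * Polynomial.C r.leadingCoeff) :=
    (associated_mul_unit_right q _ hu).irreducible hq
  have hqd : 0 < (q * Polynomial.C r.leadingCoeff).natDegree := by
    rw [Nat.pos_iff_ne_zero]
    intro h
    rw [hqm.natDegree_eq_zero] at h
    exact hqi.not_isUnit (h ▸ isUnit_one)
  rw [heq] at hP ⊢
  refine ⟨_, _, rfl, hqi, hP.of_mul hqm, ?_, ?_⟩
  · rw [mul_comm] at hP
    exact hP.of_mul hrm
  · rw [hqm.natDegree_mul hrm]
    omega

/-- `f` is the product of an element of the preordering, a power series equivalent to a power of `x`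
on the strip, and distinct irreducible polynomials which change sign inside the strip. -/
def HasStripFactorization (n : ℕ) (f : ℝ⟦X⟧⟦X⟧) : Prop :=
  ∃ t ∈ stripPreordering (2 * n), ∃ (e : ℕ) (g : ℝ⟦X⟧⟦X⟧) (b : Finset (Polynomial ℝ⟦X⟧)),
    IsMonomialOnStrip (2 * n) e g ∧
    (∀ P ∈ b, Irreducible P ∧ P.Monic ∧ HasInteriorZero n P) ∧
    f = t * g * ∏ P ∈ b, (P : ℝ⟦X⟧⟦X⟧)

theorem HasStripFactorization.mul_monomial {n e : ℕ} {f g : ℝ⟦X⟧⟦X⟧}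
    (hf : HasStripFactorization n f) (hg : IsMonomialOnStrip (2 * n) e g) :
    HasStripFactorization n (g * f) := by
  obtain ⟨t, ht, e', g', b, hg', hb, rfl⟩ := hf
  exact ⟨t, ht, _, g * g', b, hg.mul hg', hb, by ring⟩

theorem HasStripFactorization.mul_irreducible {n : ℕ} {f : ℝ⟦X⟧⟦X⟧}
    (hf : HasStripFactorization n f) {P : Polynomial ℝ⟦X⟧} (hP : Irreducible P)
    (hd : P.IsDistinguishedAt (IsLocalRing.maximalIdeal ℝ⟦X⟧)) :
    HasStripFactorization n (P * f) := by
  classical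
  rcases strip_trichotomy_of_irreducible hP hd n with (h | h) | ⟨e, h⟩ | h
  · obtain ⟨t, ht, e', g', b, hg', hb, rfl⟩ := hf
    exact ⟨P * t, mul_mem h ht, _, g', b, hg', hb, by ring⟩
  · obtain ⟨t, ht, e', g', b, hg', hb, rfl⟩ := hf
    exact ⟨-P * t, mul_mem h ht, _, -g', b, hg'.neg, hb, by ring⟩
  · exact hf.mul_monomial h
  · obtain ⟨t, ht, e', g', b, hg', hb, rfl⟩ := hf
    -- A second occurrence of P moves P² into the preordering factor, so the remaining factors stay
    -- distinct.
    by_cases hPb : P ∈ b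
    · refine ⟨P ^ 2 * t, mul_mem (sq_mem_stripPreordering _ _) ht, _, g', b.erase P, hg',
        fun Q hQ => hb Q (Finset.mem_of_mem_erase hQ), ?_⟩
      rw [← Finset.mul_prod_erase b _ hPb]
      ring
    · refine ⟨t, ht, _, g', insert P b, hg', fun Q hQ => ?_, ?_⟩
      · rcases Finset.mem_insert.1 hQ with rfl | hQ
        · exact ⟨hP, hd.monic, h⟩
        · exact hb Q hQ
      · rw [Finset.prod_insert hPb]
        ring

theorem hasStripFactorization_of_isDistinguishedAt {n : ℕ} (hn : 1 ≤ n) {P : Polynomial ℝ⟦X⟧}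
    (hP : P.IsDistinguishedAt (IsLocalRing.maximalIdeal ℝ⟦X⟧)) :
    HasStripFactorization n (P : ℝ⟦X⟧⟦X⟧) := by
  induction hd : P.natDegree using Nat.strong_induction_on generalizing P with
  | _ d ih =>
    subst hd
    by_cases h0 : P.natDegree = 0
    · rw [hP.monic.natDegree_eq_zero] at h0
      subst h0
      exact ⟨1, one_mem _, 0, 1, ∅, .of_isUnit (by omega) isUnit_one, by simp, by simp⟩
    · obtain ⟨q, r, rfl, hq, hqd, hrd, hlt⟩ := hP.exists_irreducible_mul h0
      rw [Polynomial.coe_mul]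
      exact (ih _ hlt hrd rfl).mul_irreducible hq hqd

/-- Dividing by the largest power of x leaves a series that is nonzero modulo x, as Weierstrass
preparation requires. -/
theorem hasStripFactorization {n : ℕ} (hn : 1 ≤ n) {f : ℝ⟦X⟧⟦X⟧} (hf : f ≠ 0) :
    HasStripFactorization n f := by
  have hnu : ¬ IsUnit (C X : ℝ⟦X⟧⟦X⟧) := by
    rw [PowerSeries.isUnit_iff_constantCoeff, constantCoeff_C]
    exact X_prime.not_isUnit
  obtain ⟨f', hf', hnd⟩ := (FiniteMultiplicity.of_not_isUnit hnu hf).exists_eq_pow_mul_and_not_dvd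
  have hmap : f'.map (IsLocalRing.residue ℝ⟦X⟧) ≠ 0 := by
    intro h
    apply hnd
    have hdiv : ∀ i, X ∣ coeff i f' := by
      intro i
      have := congrArg (coeff i) h
      rw [coeff_map, map_zero, IsLocalRing.residue_eq_zero_iff, maximalIdeal_eq_span_X,
        Ideal.mem_span_singleton] at this
      exact this
    choose c hc using hdiv
    exact ⟨mk c, by ext1 i; rw [coeff_C_mul, coeff_mk, hc i]⟩
  obtain ⟨P, u, hPu⟩ := exists_isWeierstrassFactorization hmap
  have key : ∀ k, HasStripFactorization n (C X ^ k * f') := by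
    intro k
    induction k with
    | zero =>
      rw [pow_zero, one_mul, hPu.eq_mul, mul_comm]
      exact (hasStripFactorization_of_isDistinguishedAt hn hPu.isDistinguishedAt).mul_monomial
        (.of_isUnit (by omega) hPu.isUnit)
    | succ k ih =>
      rw [pow_succ', mul_assoc]
      exact ih.mul_monomial (.C_X _)
  rw [hf']
  exact key _

/-- Two orderings in which `P` has opposite signs, and all other elements have the same sign. -/
theorem not_forall_pos_of_hasInteriorZero {n : ℕ} (hn : 1 ≤ n) {P : Polynomial ℝ⟦X⟧}
    (hP : Irreducible P) (hPm : P.Monic) (hz : HasInteriorZero n P) {e : ℕ} {g : ℝ⟦X⟧⟦X⟧}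
    (hg : IsMonomialOnStrip (2 * n) e g) {b : Finset (Polynomial ℝ⟦X⟧)} (hPb : P ∉ b)
    (hb : ∀ Q ∈ b, Irreducible Q ∧ Q.Monic) :
    ∃ pos : ℝ⟦X⟧⟦X⟧ → Prop, IsPosCone pos ∧ pos X ∧ pos (C X ^ (2 * n) - X) ∧
      ¬ pos (P * (g * ∏ Q ∈ b, (Q : ℝ⟦X⟧⟦X⟧))) := by
  obtain ⟨L, _, φ, pos, hp, hy, hw, hφP, hpoly, hker⟩ := hz
  set c := g * ∏ Q ∈ b, (Q : ℝ⟦X⟧⟦X⟧) with hc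
  have hx : φ (C X) ≠ 0 := by
    intro h
    rw [← Polynomial.coe_C] at h
    have h1 := hpoly _ h
    have h2 := Polynomial.natDegree_le_of_dvd h1 (by simp [X_ne_zero])
    rw [Polynomial.natDegree_C, Nat.le_zero, hPm.natDegree_eq_zero] at h2
    exact hP.not_isUnit (h2 ▸ isUnit_one)
  have hφc : φ c ≠ 0 := by
    rw [hc, map_mul, map_prod]
    refine mul_ne_zero (hg.map_ne_zero hn hp hy hw hx) (Finset.prod_ne_zero_iff.2 fun Q hQ h => ?_)
    have h1 := hpoly Q h
    have h2 : Associated P Q := hP.associated_of_dvd (hb Q hQ).1 h1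
    exact hPb (Polynomial.eq_of_monic_of_associated hPm (hb Q hQ).2 h2 ▸ hQ)
  have hP0 : (P : ℝ⟦X⟧⟦X⟧) ≠ 0 := by simpa using hPm.ne_zero
  have hPu : ¬ IsUnit (P : ℝ⟦X⟧⟦X⟧) := fun h => (h.map φ).ne_zero hφP
  -- Either P or -P can be made positive and infinitesimal over the ordering of L; the sign of c is
  -- inherited from φ c in both cases.
  have lift : ∀ s : ℝ⟦X⟧⟦X⟧, s = P ∨ s = -P → ∃ pos' : ℝ⟦X⟧⟦X⟧ → Prop, IsPosCone pos' ∧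
      pos' s ∧ ∀ b, pos (φ b) → pos' b := by
    intro s hs
    refine hp.exists_lift φ ?_ ?_ fun a ha => ?_
    · rcases hs with rfl | rfl
      · exact hP0
      · exact neg_ne_zero.2 hP0
    · rcases hs with rfl | rfl <;> simp [hφP]
    · obtain ⟨d, hd, hd'⟩ := (FiniteMultiplicity.of_not_isUnit hPu ha).exists_eq_pow_mul_and_not_dvd
      have hφd : φ d ≠ 0 := fun h => hd' (hker d h)
      rcases hs with rfl | rfl
      · exact ⟨_, d, hd, hφd⟩
      · refine ⟨multiplicity (P : ℝ⟦X⟧⟦X⟧) a,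
          (-1) ^ multiplicity (P : ℝ⟦X⟧⟦X⟧) a * d, ?_, by simpa using hφd⟩
        rw [← mul_assoc, ← mul_pow]
        simpa using hd
  obtain ⟨p1, h1, h1s, h1l⟩ := lift P (Or.inl rfl)
  obtain ⟨p2, h2, h2s, h2l⟩ := lift (-P) (Or.inr rfl)
  rcases hp.total hφc with h | h
  · refine ⟨p2, h2, h2l _ hy, h2l _ hw, fun h3 => h2.not_neg h3 ?_⟩
    rw [← neg_mul]
    exact h2.mul h2s (h2l _ h)
  · refine ⟨p1, h1, h1l _ hy, h1l _ hw, fun h3 => h1.not_neg h3 ?_⟩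
    rw [← mul_neg]
    exact h1.mul h1s (h1l _ (by rwa [map_neg]))

theorem mem_stripPreordering_of_forall_isPosCone {n : ℕ} (hn : 1 ≤ n) {f : ℝ⟦X⟧⟦X⟧}
    (h : ∀ pos : ℝ⟦X⟧⟦X⟧ → Prop, IsPosCone pos → pos X → pos (C X ^ (2 * n) - X) →
      f = 0 ∨ pos f) : f ∈ stripPreordering (2 * n) := by
  classical
  by_cases hf : f = 0
  · rw [hf]
    exact zero_mem _
  obtain ⟨t, ht, e, g, b, hg, hb, hfac⟩ := hasStripFactorization hn hf
  have ht0 : t ≠ 0 := by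
    rintro rfl
    simp at hfac
    exact hf hfac
  have hpos : ∀ pos : ℝ⟦X⟧⟦X⟧ → Prop, IsPosCone pos → pos X → pos (C X ^ (2 * n) - X) →
      pos (g * ∏ P ∈ b, (P : ℝ⟦X⟧⟦X⟧)) := by
    intro pos hp hy hw
    have h1 := (h pos hp hy hw).resolve_left hf
    rw [hfac, mul_assoc] at h1
    refine hp.of_mul ((hp.eq_zero_or_pos_of_mem (RingHom.id _) ?_ ht).resolve_left ht0) h1
    rintro s (rfl | rfl)
    · exact hy
    · exact hw
  have hb0 : b = ∅ := by
    by_contra hne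
    obtain ⟨P, hP⟩ := Finset.nonempty_iff_ne_empty.2 hne
    obtain ⟨hPi, hPm, hPz⟩ := hb P hP
    obtain ⟨pos, hp, hy, hw, hnot⟩ := not_forall_pos_of_hasInteriorZero hn hPi hPm hPz hg
      (Finset.notMem_erase P b) fun Q hQ =>
        ⟨(hb Q (Finset.mem_of_mem_erase hQ)).1, (hb Q (Finset.mem_of_mem_erase hQ)).2.1⟩
    apply hnot
    have := hpos pos hp hy hw
    rw [← Finset.mul_prod_erase b _ hP] at this
    convert! this using 1
    ring
  subst hb0
  simp only [Finset.prod_empty, mul_one] at hpos hfac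
  obtain ⟨u, hu, hgu⟩ := hg.1
  have hu0 : constantCoeff u ≠ 0 := (hu.map constantCoeff).ne_zero
  have hupos : 0 < constantCoeff u := by
    by_contra! hle
    -- The ordering with x > 0 rules out a negative leading unit; below, the one with x < 0 rules
    -- out odd e.
    obtain ⟨pos, hp, hy, hw, hl⟩ := exists_isPosCone_strip n (s := X) (Or.inl rfl)
    refine hp.not_neg (hpos pos hp hy hw) (hl e (-u) _ ?_ ?_)
    · rw [map_neg]
      exact neg_pos.2 (lt_of_le_of_ne hle hu0)
    · rw [map_neg, hgu, mul_neg]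
  rcases Nat.even_or_odd' e with ⟨k, rfl | rfl⟩
  · obtain ⟨δ, hδ, hmem⟩ := hg.exists_sub_mem hn hgu hupos
    rw [hfac]
    refine mul_mem ht ?_
    have h1 : C (C δ) * C X ^ (2 * k) ∈ stripPreordering (2 * n) := by
      rw [mul_comm 2 k, pow_mul]
      exact mul_mem (mem_stripPreordering_of_pos _ (by simpa using hδ))
        (sq_mem_stripPreordering _ _)
    simpa using add_mem hmem h1
  · exfalso
    obtain ⟨pos, hp, hy, hw, hl⟩ := exists_isPosCone_strip n (s := -X) (Or.inr rfl)
    refine hp.not_neg (hpos pos hp hy hw) (hl (2 * k + 1) u _ hupos ?_)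
    rw [map_neg, hgu, Odd.neg_pow ⟨k, rfl⟩, neg_mul]

end

/-! ### From positive cones to ordered fields, and normal forms in a preordering. -/

section

open PowerSeries

namespace IsPosCone

theorem exists_linearOrder {F : Type*} [Field F] {pos : F → Prop} (h : IsPosCone pos) :
    ∃ (_ : LinearOrder F) (_ : IsStrictOrderedRing F), ∀ a : F, 0 < a ↔ pos a := by
  classical
  let c : RingCone F :=
    { carrier := {a | a = 0 ∨ pos a}
      zero_mem' := Or.inl rfl
      one_mem' := Or.inr h.one
      add_mem' := by
        rintro a b (rfl | ha) (rfl | hb)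
        · simp
        · simpa using Or.inr hb
        · simpa using Or.inr ha
        · exact Or.inr (h.add ha hb)
      mul_mem' := by
        rintro a b (rfl | ha) (rfl | hb)
        · simp
        · simp
        · simp
        · exact Or.inr (h.mul ha hb)
      eq_zero_of_mem_of_neg_mem' := by
        rintro a (rfl | ha) hb
        · rfl
        · rcases hb with hb | hb
          · simpa using hb
          · exact absurd hb (h.not_neg ha) }
  have hmem : ∀ a, a ∈ c ↔ a = 0 ∨ pos a := fun a => Iff.rfl
  have htot : HasMemOrNegMem c := ⟨fun a => by
    rw [hmem, hmem]
    by_cases ha : a = 0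
    · exact Or.inl (Or.inl ha)
    · exact (h.total ha).imp Or.inr Or.inr⟩
  let lo : LinearOrder F := LinearOrder.mkOfAddGroupCone c
  have hor : IsOrderedRing F := IsOrderedRing.mkOfCone c
  refine ⟨lo, IsOrderedRing.toIsStrictOrderedRing F, fun a => ?_⟩
  have hle : 0 ≤ a ↔ a = 0 ∨ pos a := by
    change a - 0 ∈ c ↔ _
    rw [sub_zero, hmem]
  rw [lt_iff_le_and_ne, hle]
  constructor
  · rintro ⟨h1, h2⟩
    exact h1.resolve_left h2.symm
  · intro h1
    refine ⟨Or.inr h1, ?_⟩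
    rintro rfl
    exact h.zero h1

theorem exists_linearOrder_fractionRing {D : Type*} [CommRing D] [IsDomain D] {pos : D → Prop}
    (h : IsPosCone pos) :
    ∃ (_ : LinearOrder (FractionRing D)) (_ : IsStrictOrderedRing (FractionRing D)),
      ∀ a : D, 0 < algebraMap D (FractionRing D) a ↔ pos a := by
  set F := FractionRing D
  set i := algebraMap D F
  have hi : Function.Injective i := IsFractionRing.injective D F
  have hne : ∀ {a : D}, pos a → i a ≠ 0 := fun {a} ha h0 => h.zero (by
    rwa [(map_eq_zero_iff i hi).1 h0] at ha)
  have hF : IsPosCone fun z : F => ∃ a b : D, pos a ∧ pos b ∧ z = i a / i b := by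
    refine ⟨?_, ?_, ?_, ?_⟩
    · rintro _ _ ⟨a, b, ha, hb, rfl⟩ ⟨c, d, hc, hd, rfl⟩
      refine ⟨a * d + b * c, b * d, h.add (h.mul ha hd) (h.mul hb hc), h.mul hb hd, ?_⟩
      rw [div_add_div _ _ (hne hb) (hne hd)]
      simp
    · rintro _ _ ⟨a, b, ha, hb, rfl⟩ ⟨c, d, hc, hd, rfl⟩
      exact ⟨a * c, b * d, h.mul ha hc, h.mul hb hd, by rw [div_mul_div_comm]; simp⟩
    · rintro ⟨a, b, ha, hb, h0⟩
      exact div_ne_zero (hne ha) (hne hb) h0.symm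
    · intro z hz
      obtain ⟨a, b, hb, rfl⟩ := IsFractionRing.div_surjective (A := D) z
      have hb0 := nonZeroDivisors.ne_zero hb
      have ha0 : a ≠ 0 := by
        rintro rfl
        simp at hz
      rcases h.total ha0 with ha | ha <;> rcases h.total hb0 with hb | hb
      · exact Or.inl ⟨a, b, ha, hb, rfl⟩
      · exact Or.inr ⟨a, -b, ha, hb, by simp [i, div_neg]⟩
      · exact Or.inr ⟨-a, b, ha, hb, by simp [i, neg_div]⟩
      · exact Or.inl ⟨-a, -b, ha, hb, by simp [i]⟩
  obtain ⟨lo, so, hlo⟩ := hF.exists_linearOrder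
  refine ⟨lo, so, fun a => (hlo _).trans ⟨?_, fun ha => ⟨a, 1, ha, h.one, by simp⟩⟩⟩
  rintro ⟨c, d, hc, hd, hcd⟩
  rw [eq_div_iff (hne hd), ← map_mul, hi.eq_iff] at hcd
  exact h.of_mul hd (by rwa [mul_comm, hcd])

end IsPosCone

/-- In products, g² and h² are absorbed into the sums of squares. This normal form is what allows
even parts in x to be taken for part (2). -/
theorem exists_isSumSq_of_mem_generatedPreordering {R : Type*} [CommRing R] {g h a : R}
    (ha : a ∈ generatedPreordering {g, h}) :
    ∃ s₀ s₁ s₂ s₃ : R, IsSumSq s₀ ∧ IsSumSq s₁ ∧ IsSumSq s₂ ∧ IsSumSq s₃ ∧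
      a = s₀ + s₁ * g + s₂ * h + s₃ * (g * h) := by
  have h0 : IsSumSq (0 : R) := IsSumSq.zero
  have h1 : IsSumSq (1 : R) := IsSquare.one.isSumSq
  induction ha using Subsemiring.closure_induction with
  | mem a ha =>
    rcases ha with ha | rfl | rfl
    · exact ⟨a, 0, 0, 0, ha.isSumSq, h0, h0, h0, by ring⟩
    · exact ⟨0, 1, 0, 0, h0, h1, h0, h0, by ring⟩
    · exact ⟨0, 0, 1, 0, h0, h0, h1, h0, by ring⟩
  | zero => exact ⟨0, 0, 0, 0, h0, h0, h0, h0, by ring⟩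
  | one => exact ⟨1, 0, 0, 0, h1, h0, h0, h0, by ring⟩
  | add a b _ _ ha hb =>
    obtain ⟨s₀, s₁, s₂, s₃, hs₀, hs₁, hs₂, hs₃, rfl⟩ := ha
    obtain ⟨t₀, t₁, t₂, t₃, ht₀, ht₁, ht₂, ht₃, rfl⟩ := hb
    exact ⟨s₀ + t₀, s₁ + t₁, s₂ + t₂, s₃ + t₃, hs₀.add ht₀, hs₁.add ht₁, hs₂.add ht₂, hs₃.add ht₃,
      by ring⟩
  | mul a b _ _ ha hb =>
    obtain ⟨s₀, s₁, s₂, s₃, hs₀, hs₁, hs₂, hs₃, rfl⟩ := ha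
    obtain ⟨t₀, t₁, t₂, t₃, ht₀, ht₁, ht₂, ht₃, rfl⟩ := hb
    have hg : IsSumSq (g * g) := (IsSquare.mul_self g).isSumSq
    have hh : IsSumSq (h * h) := (IsSquare.mul_self h).isSumSq
    refine ⟨s₀ * t₀ + s₁ * t₁ * (g * g) + s₂ * t₂ * (h * h) + s₃ * t₃ * (g * g) * (h * h),
      s₀ * t₁ + s₁ * t₀ + s₂ * t₃ * (h * h) + s₃ * t₂ * (h * h),
      s₀ * t₂ + s₂ * t₀ + s₁ * t₃ * (g * g) + s₃ * t₁ * (g * g),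
      s₀ * t₃ + s₃ * t₀ + s₁ * t₂ + s₂ * t₁, ?_, ?_, ?_, ?_, by ring⟩
    · exact (((hs₀.mul ht₀).add ((hs₁.mul ht₁).mul hg)).add ((hs₂.mul ht₂).mul hh)).add
        (((hs₃.mul ht₃).mul hg).mul hh)
    · exact (((hs₀.mul ht₁).add (hs₁.mul ht₀)).add ((hs₂.mul ht₃).mul hh)).add
        ((hs₃.mul ht₂).mul hh)
    · exact (((hs₀.mul ht₂).add (hs₂.mul ht₀)).add ((hs₁.mul ht₃).mul hg)).add
        ((hs₃.mul ht₁).mul hg)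
    · exact (((hs₀.mul ht₃).add (hs₃.mul ht₀)).add (hs₁.mul ht₂)).add (hs₂.mul ht₁)

/-! ### The substitution x ↦ x² and part (2). -/

/-- The substitution `x ↦ x ^ 2` on `ℝ⟦x⟧⟦y⟧`. -/
noncomputable def squareX : ℝ⟦X⟧⟦X⟧ →+* ℝ⟦X⟧⟦X⟧ :=
  PowerSeries.map (PowerSeries.expand 2 two_ne_zero : ℝ⟦X⟧ →ₐ[ℝ] ℝ⟦X⟧).toRingHom

theorem squareX_X : squareX X = X := by simp [squareX]

theorem squareX_C_X : squareX (C X) = C X ^ 2 := by simp [squareX]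

theorem coeff_coeff_squareX (a : ℝ⟦X⟧⟦X⟧) (i j : ℕ) :
    coeff (2 * i) (coeff j (squareX a)) = coeff i (coeff j a) := by
  simp only [squareX, coeff_map]
  exact coeff_expand_mul 2 two_ne_zero _ i

theorem coeff_odd_coeff_squareX (a : ℝ⟦X⟧⟦X⟧) (i j : ℕ) :
    coeff (2 * i + 1) (coeff j (squareX a)) = 0 := by
  simp only [squareX, coeff_map]
  exact coeff_expand_of_not_dvd 2 two_ne_zero _ (by omega)

theorem squareX_injective : Function.Injective squareX := by
  intro a b h
  ext j i
  rw [← coeff_coeff_squareX, h, coeff_coeff_squareX]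

theorem exists_eq_squareX_add (a : ℝ⟦X⟧⟦X⟧) : ∃ b c, a = squareX b + C X * squareX c := by
  refine ⟨mk fun j => mk fun i => coeff (2 * i) (coeff j a),
    mk fun j => mk fun i => coeff (2 * i + 1) (coeff j a), ?_⟩
  ext j k
  rw [map_add, coeff_C_mul, map_add]
  rcases Nat.even_or_odd' k with ⟨i, rfl | rfl⟩
  · rw [coeff_coeff_squareX]
    rcases i with _ | i
    · simp
    · rw [show 2 * (i + 1) = 2 * i + 1 + 1 by ring, coeff_succ_X_mul, coeff_odd_coeff_squareX]
      simp [mul_add]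
  · rw [coeff_odd_coeff_squareX, coeff_succ_X_mul, coeff_coeff_squareX]
    simp

theorem eq_of_squareX_eq {a b c : ℝ⟦X⟧⟦X⟧} (h : squareX a = squareX b + C X * squareX c) :
    a = b := by
  ext j i
  have := congrArg (fun z => coeff (2 * i) (coeff j z)) h
  simp only [map_add, coeff_C_mul, coeff_coeff_squareX] at this
  rw [this]
  rcases i with _ | i
  · simp
  · rw [show 2 * (i + 1) = 2 * i + 1 + 1 by ring, coeff_succ_X_mul, coeff_odd_coeff_squareX,
      add_zero]

/-- An ordering pulled back along x ↦ x² makes x positive, so part (1) applies to f(x², y). Both y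
and x^(2n) - y are even in x, so only even parts of the sums of squares matter, and these come from
T. -/
theorem mem_generatedPreordering_of_forall_isPosCone {n : ℕ} (hn : 1 ≤ n) {f : ℝ⟦X⟧⟦X⟧}
    (h : ∀ pos : ℝ⟦X⟧⟦X⟧ → Prop, IsPosCone pos → pos (C X) → pos X → pos (C X ^ n - X) →
      f = 0 ∨ pos f) : f ∈ generatedPreordering {C X, X, C X ^ n - X} := by
  set T := generatedPreordering ({C X, X, C X ^ n - X} : Set ℝ⟦X⟧⟦X⟧) with hT
  have hsq : ∀ a : ℝ⟦X⟧⟦X⟧, a * a ∈ T := fun a => Subsemiring.subset_closure (Or.inl ⟨a, rfl⟩)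
  have hx : C X ∈ T := Subsemiring.subset_closure (Or.inr (Or.inl rfl))
  have hy : X ∈ T := Subsemiring.subset_closure (Or.inr (Or.inr (Or.inl rfl)))
  have hw : C X ^ n - X ∈ T := Subsemiring.subset_closure (Or.inr (Or.inr (Or.inr rfl)))
  have hw' : squareX (C X ^ n - X) = C X ^ (2 * n) - X := by
    rw [map_sub, map_pow, squareX_C_X, squareX_X, pow_mul]
  have hmem : squareX f ∈ stripPreordering (2 * n) := by
    refine mem_stripPreordering_of_forall_isPosCone hn fun pos hp h1 h2 => ?_
    rw [map_eq_zero_iff _ squareX_injective]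
    refine h _ (hp.comap squareX squareX_injective) ?_ ?_ ?_
    · rw [squareX_C_X, pow_two]
      exact hp.mul_self fun h => X_ne_zero (R := ℝ) (by simpa using congrArg constantCoeff h)
    · rwa [squareX_X]
    · rwa [hw']
  have hsum : ∀ s : ℝ⟦X⟧⟦X⟧, IsSumSq s → ∃ p ∈ T, ∃ q, s = squareX p + C X * squareX q := by
    intro s hs
    induction hs with
    | zero => exact ⟨0, zero_mem _, 0, by simp⟩
    | sq_add a _ ih =>
      obtain ⟨p, hp, q, rfl⟩ := ih
      obtain ⟨b, c, rfl⟩ := exists_eq_squareX_add a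
      -- Squaring b(x²) + x c(x²) gives even part b² + x c² and odd part 2bc, as series in x²; x ∈ T
      -- keeps the former in T.
      refine ⟨b * b + C X * (c * c) + p, add_mem (add_mem (hsq b) (mul_mem hx (hsq c))) hp,
        2 * b * c + q, ?_⟩
      simp only [map_add, map_mul, squareX_C_X, map_ofNat]
      ring
  obtain ⟨s₀, s₁, s₂, s₃, hs₀, hs₁, hs₂, hs₃, hf⟩ :=
    exists_isSumSq_of_mem_generatedPreordering hmem
  obtain ⟨p₀, hp₀, q₀, rfl⟩ := hsum s₀ hs₀
  obtain ⟨p₁, hp₁, q₁, rfl⟩ := hsum s₁ hs₁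
  obtain ⟨p₂, hp₂, q₂, rfl⟩ := hsum s₂ hs₂
  obtain ⟨p₃, hp₃, q₃, rfl⟩ := hsum s₃ hs₃
  set w : ℝ⟦X⟧⟦X⟧ := C X ^ n - X with hwdef
  rw [eq_of_squareX_eq (a := f) (b := p₀ + p₁ * X + p₂ * w + p₃ * (X * w))
    (c := q₀ + q₁ * X + q₂ * w + q₃ * (X * w)) (by
      rw [hf, ← hw']
      simp only [map_add, map_mul, squareX_X]
      ring)]
  exact add_mem (add_mem (add_mem hp₀ (mul_mem hp₁ hy)) (mul_mem hp₂ hw))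
    (mul_mem hp₃ (mul_mem hy hw))

/-! ### Transfer to ℝ⟦x, y⟧ and its field of fractions. -/

/-- The bijection of `Fin 2` with `Option Unit` that sends `1` to `none`. -/
def finTwoEquivOptionUnit : Fin 2 ≃ Option Unit where
  toFun := ![some (), none]
  invFun o := o.elim 1 fun _ => 0
  left_inv i := by fin_cases i <;> rfl
  right_inv := by rintro (_ | _) <;> rfl

/-- The isomorphism `ℝ⟦x, y⟧ ≃ ℝ⟦x⟧⟦y⟧`. -/
noncomputable def equivIterated : PowerSeriesXY ≃+* ℝ⟦X⟧⟦X⟧ :=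
  ((MvPowerSeries.renameEquiv ℝ finTwoEquivOptionUnit).trans
    (MvPowerSeries.optionEquivLeft Unit ℝ)).toRingEquiv

instance PowerSeriesXY.isDomain : IsDomain PowerSeriesXY :=
  equivIterated.toMulEquiv.isDomain ℝ⟦X⟧⟦X⟧

theorem equivIterated_x : equivIterated PowerSeriesXY.x = C X := by
  change MvPowerSeries.optionEquivLeft Unit ℝ
    (MvPowerSeries.rename finTwoEquivOptionUnit (MvPowerSeries.X 0)) = _
  rw [MvPowerSeries.rename_X]
  exact MvPowerSeries.optionEquivLeft_X_some _

theorem equivIterated_y : equivIterated PowerSeriesXY.y = X := by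
  change MvPowerSeries.optionEquivLeft Unit ℝ
    (MvPowerSeries.rename finTwoEquivOptionUnit (MvPowerSeries.X 1)) = _
  rw [MvPowerSeries.rename_X]
  exact MvPowerSeries.optionEquivLeft_X_none

theorem map_mem_generatedPreordering {A B : Type*} [CommRing A] [CommRing B] (φ : A →+* B)
    {S : Set A} {a : A} (h : a ∈ generatedPreordering S) :
    φ a ∈ generatedPreordering (φ '' S) := by
  have : generatedPreordering S ≤ (generatedPreordering (φ '' S)).comap φ := by
    refine Subsemiring.closure_le.2 ?_
    rintro b (hb | hb)
    · exact Subsemiring.subset_closure (Or.inl (hb.map φ))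
    · exact Subsemiring.subset_closure (Or.inr ⟨b, hb, rfl⟩)
  exact this h

theorem mem_generatedPreordering_iff_of_equiv {A B : Type*} [CommRing A] [CommRing B] (e : A ≃+* B)
    {S : Set A} {a : A} : e a ∈ generatedPreordering (e '' S) ↔ a ∈ generatedPreordering S := by
  refine ⟨fun h => ?_, map_mem_generatedPreordering e.toRingHom⟩
  have := map_mem_generatedPreordering e.symm.toRingHom h
  simpa [Set.image_image] using this

theorem eq_zero_or_pos_of_forall_ordering {D : Type*} [CommRing D] [IsDomain D] {f : D} {S : Set D}
    (h : ∀ [LinearOrder (FractionRing D)] [IsStrictOrderedRing (FractionRing D)],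
      (∀ a ∈ S, 0 < algebraMap D (FractionRing D) a) → 0 ≤ algebraMap D (FractionRing D) f)
    {pos : D → Prop} (hp : IsPosCone pos) (hS : ∀ a ∈ S, pos a) : f = 0 ∨ pos f := by
  obtain ⟨_, _, hpos⟩ := hp.exists_linearOrder_fractionRing
  rcases (h fun a ha => (hpos a).2 (hS a ha)).eq_or_lt with h0 | h0
  · exact Or.inl ((IsFractionRing.injective D (FractionRing D)) (by rw [← h0, map_zero]))
  · exact Or.inr ((hpos f).1 h0)

end

theorem theorem2p3 (f : PowerSeriesXY) (n : ℕ) (hn : 1 ≤ n) :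
    ((∀ [LinearOrder FracXY] [IsStrictOrderedRing FracXY],
        0 < algebraMap PowerSeriesXY FracXY PowerSeriesXY.y →
        0 < algebraMap PowerSeriesXY FracXY (PowerSeriesXY.x ^ (2 * n) - PowerSeriesXY.y) →
        0 ≤ algebraMap PowerSeriesXY FracXY f) →
      f ∈ generatedPreordering {PowerSeriesXY.y, PowerSeriesXY.x ^ (2 * n) - PowerSeriesXY.y}) ∧
    ((∀ [LinearOrder FracXY] [IsStrictOrderedRing FracXY],
        0 < algebraMap PowerSeriesXY FracXY PowerSeriesXY.x →
        0 < algebraMap PowerSeriesXY FracXY PowerSeriesXY.y →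
        0 < algebraMap PowerSeriesXY FracXY (PowerSeriesXY.x ^ n - PowerSeriesXY.y) →
        0 ≤ algebraMap PowerSeriesXY FracXY f) →
      f ∈ generatedPreordering {PowerSeriesXY.x, PowerSeriesXY.y, PowerSeriesXY.x ^ n - PowerSeriesXY.y}) := by
  have hzero : equivIterated f = 0 ↔ f = 0 := map_eq_zero_iff _ equivIterated.injective
  have hlift : ∀ {S : Set PowerSeriesXY},
      (∀ [LinearOrder FracXY] [IsStrictOrderedRing FracXY],
        (∀ a ∈ S, 0 < algebraMap PowerSeriesXY FracXY a) →
          0 ≤ algebraMap PowerSeriesXY FracXY f) →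
      ∀ pos : PowerSeries (PowerSeries ℝ) → Prop, IsPosCone pos → (∀ a ∈ S, pos (equivIterated a)) →
        equivIterated f = 0 ∨ pos (equivIterated f) := fun h pos hp hS =>
    (eq_zero_or_pos_of_forall_ordering h
      (hp.comap equivIterated.toRingHom equivIterated.injective) hS).imp_left hzero.2
  constructor
  · intro h
    rw [← mem_generatedPreordering_iff_of_equiv equivIterated, Set.image_pair, map_sub, map_pow,
      equivIterated_x, equivIterated_y]
    refine mem_stripPreordering_of_forall_isPosCone hn fun pos hp h1 h2 =>
      hlift (S := {PowerSeriesXY.y, PowerSeriesXY.x ^ (2 * n) - PowerSeriesXY.y})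
        (fun hS => h (hS _ (by simp)) (hS _ (by simp))) pos hp ?_
    rintro a (rfl | rfl)
    · rwa [equivIterated_y]
    · rwa [map_sub, map_pow, equivIterated_x, equivIterated_y]
  · intro h
    rw [← mem_generatedPreordering_iff_of_equiv equivIterated, Set.image_insert_eq,
      Set.image_pair, map_sub, map_pow, equivIterated_x, equivIterated_y]
    refine mem_generatedPreordering_of_forall_isPosCone hn fun pos hp h1 h2 h3 =>
      hlift (S := {PowerSeriesXY.x, PowerSeriesXY.y, PowerSeriesXY.x ^ n - PowerSeriesXY.y})
        (fun hS => h (hS _ (by simp)) (hS _ (by simp)) (hS _ (by simp))) pos hp ?_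
    rintro a (rfl | rfl | rfl)
    · rwa [equivIterated_x]
    · rwa [equivIterated_y]
    · rwa [map_sub, map_pow, equivIterated_x, equivIterated_y]
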